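/- Let $d\ge 2$ be an integer and let $q,s$ be real numbers with $q>1$ and $qs\ge 1$. For a unit vector $|\psi\rangle\in\mathbb{C}^d\otimes\mathbb{C}^d$ with reduced density matrix $\rho_A=\operatorname{tr}_B|\psi\rangle\langle\psi|$, let $$C_{q,s}(|\psi\rangle)=1-(\operatorname{tr}\rho_A^q)^s$$ be its unified $(q,s)$-concurrence, and for a mixed state $\rho$ on $\mathbb{C}^d\otimes\mathbb{C}^d$ let $$C_{q,s}(\rho)=\inf_{\{p_i,|\psi_i\rangle\}}\sum_i p_i\,C_{q,s}(|\psi_i\rangle),$$ the infimum being over all finite decompositions $\rho=\sum_i p_i|\psi_i\rangle\langle\psi_i|$ into pure states with $p_i\ge 0$, $\sum_i p_i=1$. For $i<k$ put $|\Phi_{ik}^\pm\rangle=(|ik\rangle\pm|ki\rangle)/\sqrt2$, let $P^-=\sum_{i<k}|\Phi_{ik}^-\rangle\langle\Phi_{ik}^-|$, and for $w\in[0,1]$ let $$\rho_w=\frac{2(1-w)}{d(d+1)}\Big(\sum_{i=1}^d|ii\rangle\langle ii|+\sum_{i<k}|\Phi_{ik}^+\rangle\langle\Phi_{ik}^+|\Big)+\frac{2w}{d(d-1)}\,P^-$$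 be the Werner state with parameter $w=\operatorname{tr}(\rho_wP^-)$. Then: 1. For every $w\in[0,1]$ the minimum $$\xi(\rho_w)=\min\big\{C_{q,s}(|\psi\rangle)\;:\;|\psi\rangle \text{ a unit vector with } \operatorname{tr}(|\psi\rangle\langle\psi|\,P^-)=w\big\}$$ exists. 2. $\xi(\rho_w)=0$ for $0\le w\le\frac12$. 3. For $\frac12<w\le 1$, with $G=2\sqrt{w(1-w)}$, $$\xi(\rho_w)=1-\left[\left(\frac{1+G}{2}\right)^q+\left(\frac{1-G}{2}\right)^q\right]^s.$$ 4. The function $w\mapsto C_{q,s}(\rho_w)$ is the convex envelope on $[0,1]$ of $w\mapsto\xi(\rho_w)$, i.e. the largest convex function on $[0,1]$ that is bounded above by $\xi$. -/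

import Mathlib

noncomputable section

namespace QSConcurrence

/-- Vectors of `ℂ^d ⊗ ℂ^d`; the entry `ψ (i, k)` is the amplitude of `|ik⟩`. -/
abbrev BipVec (d : ℕ) : Type := EuclideanSpace ℂ (Fin d × Fin d)

/-- Operators on `ℂ^d ⊗ ℂ^d`. -/
abbrev BipOp (d : ℕ) : Type := Matrix (Fin d × Fin d) (Fin d × Fin d) ℂ

/-- The operator `|ψ⟩⟨ψ|`. -/
def ketBra {d : ℕ} (ψ : BipVec d) : BipOp d :=
  Matrix.of fun a b => ψ a * star (ψ b)

/-- The reduced operator `tr_B ρ` on the first factor. -/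
def reducedA {d : ℕ} (ρ : BipOp d) : Matrix (Fin d) (Fin d) ℂ :=
  Matrix.of fun i j => ∑ k, ρ (i, k) (j, k)

/-- `tr ρ^q` for a positive semidefinite matrix `ρ`, the power being taken by the continuous
functional calculus, i.e. on the eigenvalues. -/
def tracePow {d : ℕ} (ρ : Matrix (Fin d) (Fin d) ℂ) (q : ℝ) : ℝ :=
  (Matrix.trace (cfc (fun x : ℝ => x ^ q) ρ)).re

/-- The sign factor: `1` if `q ≥ 1` and `qs ≥ 1`, and `-1` in the other range
`0 < q < 1`, `0 < qs < 1` in which the concurrence is defined. -/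
def signFactor (q s : ℝ) : ℝ :=
  open Classical in if 1 ≤ q ∧ 1 ≤ q * s then 1 else -1

/-- The unified `(q,s)`-concurrence of a (unit) vector. -/
def pureConcurrence {d : ℕ} (q s : ℝ) (ψ : BipVec d) : ℝ :=
  signFactor q s * (1 - tracePow (reducedA (ketBra ψ)) q ^ s)

/-- The average concurrences `∑ i, p i * C (ψ i)` over all (finite) decompositions
`ρ = ∑ i, p i |ψ i⟩⟨ψ i|` into pure states. -/
def decompositionValues {d : ℕ} (q s : ℝ) (ρ : BipOp d) : Set ℝ :=
  {x | ∃ (n : ℕ) (p : Fin n → ℝ) (ψ : Fin n → BipVec d),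
    (∀ i, 0 ≤ p i) ∧ ∑ i, p i = 1 ∧ (∀ i, ‖ψ i‖ = 1) ∧
    ρ = ∑ i, (p i : ℂ) • ketBra (ψ i) ∧
    x = ∑ i, p i * pureConcurrence q s (ψ i)}

/-- The unified `(q,s)`-concurrence of a mixed state, by convex roof. -/
def concurrence {d : ℕ} (q s : ℝ) (ρ : BipOp d) : ℝ :=
  sInf (decompositionValues q s ρ)

/-- The basis vector `|ik⟩`. -/
def ket {d : ℕ} (i k : Fin d) : BipVec d := EuclideanSpace.single (i, k) 1

/-- `|Φ⁺_{ik}⟩ = (|ik⟩ + |ki⟩)/√2`. -/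
def phiPlus {d : ℕ} (i k : Fin d) : BipVec d := ((1 / √2 : ℝ) : ℂ) • (ket i k + ket k i)

/-- `|Φ⁻_{ik}⟩ = (|ik⟩ - |ki⟩)/√2`. -/
def phiMinus {d : ℕ} (i k : Fin d) : BipVec d := ((1 / √2 : ℝ) : ℂ) • (ket i k - ket k i)

/-- `∑_{i<k} |Φ⁻_{ik}⟩⟨Φ⁻_{ik}|`, the projection onto the antisymmetric subspace. -/
def antisymProj (d : ℕ) : BipOp d :=
  ∑ a : Fin d × Fin d with a.1 < a.2, ketBra (phiMinus a.1 a.2)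

/-- `∑_i |ii⟩⟨ii| + ∑_{i<k} |Φ⁺_{ik}⟩⟨Φ⁺_{ik}|`, the projection onto the symmetric subspace. -/
def symProj (d : ℕ) : BipOp d :=
  ∑ i : Fin d, ketBra (ket i i) +
    ∑ a : Fin d × Fin d with a.1 < a.2, ketBra (phiPlus a.1 a.2)

/-- The Werner state `ρ_w`. -/
def wernerState (d : ℕ) (w : ℝ) : BipOp d :=
  ((2 * (1 - w) / (d * (d + 1)) : ℝ) : ℂ) • symProj d +
    ((2 * w / (d * (d - 1)) : ℝ) : ℂ) • antisymProj d

/-- The Werner parameter `w(ρ) = tr (ρ ∑_{i<k} |Φ⁻_{ik}⟩⟨Φ⁻_{ik}|)`. -/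
def wernerParam {d : ℕ} (ρ : BipOp d) : ℝ :=
  (Matrix.trace (ρ * antisymProj d)).re

/-- The concurrences of the pure states with Werner parameter `w`. -/
def wernerPureValues (d : ℕ) (q s w : ℝ) : Set ℝ :=
  {x | ∃ ψ : BipVec d, ‖ψ‖ = 1 ∧ wernerParam (ketBra ψ) = w ∧ x = pureConcurrence q s ψ}

/-- The function `ξ`: the least concurrence of a pure state with Werner parameter `w`. -/
def wernerXi (d : ℕ) (q s w : ℝ) : ℝ := sInf (wernerPureValues d q s w)

/-- `g` is, on `S`, the convex envelope of `f`: the largest convex function on `S` that is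
bounded above by `f`. -/
def IsConvexEnvelopeOn (S : Set ℝ) (f g : ℝ → ℝ) : Prop :=
  ConvexOn ℝ S g ∧ (∀ x ∈ S, g x ≤ f x) ∧
    ∀ h : ℝ → ℝ, ConvexOn ℝ S h → (∀ x ∈ S, h x ≤ f x) → ∀ x ∈ S, h x ≤ g x

end QSConcurrence

end

/-! Let `F` exchange the factors, so `P⁻ = (1 - F)/2` and the Werner parameter of `ψ` is the squared
norm of its odd part.

Lower bound on `ξ` for `w ≥ 1/2`: an eigenvalue of `ρ_A` is the squared overlap of `ψ` with a
normalized product vector (unless it is `0`). A product vector `φ = a ⊗ b` satisfies `⟨φ, Fφ⟩ = |⟨a,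
b⟩|² ≥ 0`, so its odd part is no larger than its even part. Cauchy–Schwarz in each parity then
bounds every eigenvalue by `(1 + G)/2` (`norm_inner_sq_le_of_involution`,
`eigenvalues_reducedA_le`), and convexity of `t ^ q` bounds `tr ρ_A^q` (`sum_rpow_le_of_le`).
Equality holds for `optimalVec`, whose Schmidt weights are `(1 ± G)/2`. For `w ≤ 1/2` a product
vector with parameter `w` exists and has concurrence `0`.

Envelope: `ρ_w` is a mixture of pure states all of concurrence `ξ(w)`, so `ξ(w)` is a decomposition
value of `ρ_w`. Finite averages replace the Haar twirl here (`wernerState_mem_of_convex`,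
`wernerState_zero_mem_of_convex`). Since `w ↦ ρ_w` is affine, the convex roof is a convex minorant
of `ξ`. Conversely, the Werner parameters in any decomposition of `ρ_w` average to `w`, and Jensen
puts every convex minorant of `ξ` below the convex roof (`le_of_mem_decompositionValues`). -/

namespace QSConcurrence

/-! ### Power traces and extremal power sums -/

section Spectral

variable {d : ℕ}

theorem trace_cfc_eq_sum {A : Matrix (Fin d) (Fin d) ℂ} (hA : A.IsHermitian) (f : ℝ → ℝ) :
    (cfc f A).trace = ∑ i, (f (hA.eigenvalues i) : ℂ) := by
  rw [hA.cfc_eq, Matrix.IsHermitian.cfc, Unitary.conjStarAlgAut_apply, Matrix.trace_mul_comm,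
    ← mul_assoc]
  simp [Matrix.trace_diagonal]

theorem tracePow_eq_sum {A : Matrix (Fin d) (Fin d) ℂ} (hA : A.IsHermitian) (q : ℝ) :
    tracePow A q = ∑ i, hA.eigenvalues i ^ q := by
  rw [tracePow, trace_cfc_eq_sum hA, ← Complex.ofReal_sum, Complex.ofReal_re]

theorem sum_eigenvalues_eq_re_trace {A : Matrix (Fin d) (Fin d) ℂ} (hA : A.IsHermitian) :
    ∑ i, hA.eigenvalues i = A.trace.re := by
  rw [hA.trace_eq_sum_eigenvalues]
  simp

theorem sum_eigenvalues_sq_eq_re_trace {A : Matrix (Fin d) (Fin d) ℂ} (hA : A.IsHermitian) :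
    ∑ i, hA.eigenvalues i ^ 2 = (A * A).trace.re := by
  have h := trace_cfc_eq_sum hA (fun x => x ^ 2)
  rw [cfc_pow_id A 2 hA.isSelfAdjoint, sq] at h
  rw [h, ← Complex.ofReal_sum, Complex.ofReal_re]

/-- A matrix annihilated by `x (x - m) (x - n)` with the traces of `diag (m, n)` has the power
traces of `diag (m, n)`. -/
theorem tracePow_eq_of_cubic {A : Matrix (Fin d) (Fin d) ℂ} (hA : A.IsHermitian) {m n q : ℝ}
    (hq : q ≠ 0)
    (h3 : A * (A * A) = ((m + n : ℝ) : ℂ) • (A * A) - ((m * n : ℝ) : ℂ) • A)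
    (h1 : A.trace.re = m + n) (h2 : (A * A).trace.re = m ^ 2 + n ^ 2) :
    tracePow A q = m ^ q + n ^ q := by
  -- The eigenvalues lie in `{0, m, n}`. There `x ^ q` agrees with a quadratic without constant
  -- term, whose trace is fixed by `tr A` and `tr A²`, so multiplicities never enter.
  obtain ⟨α, β, hm, hn⟩ : ∃ α β : ℝ, m ^ q = α * m + β * m ^ 2 ∧ n ^ q = α * n + β * n ^ 2 := by
    by_cases hm : m = 0
    · by_cases hn : n = 0
      · exact ⟨0, 0, by simp [hm, Real.zero_rpow hq], by simp [hn, Real.zero_rpow hq]⟩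
      · exact ⟨n ^ q / n, 0, by simp [hm, Real.zero_rpow hq], by field_simp; ring⟩
    by_cases hn : n = 0
    · exact ⟨m ^ q / m, 0, by field_simp; ring, by simp [hn, Real.zero_rpow hq]⟩
    by_cases hmn : m = n
    · exact ⟨m ^ q / m, 0, by field_simp; ring, by subst hmn; field_simp; ring⟩
    · have h' : m - n ≠ 0 := sub_ne_zero.2 hmn
      -- `α + β x` is the linear interpolant of `x ^ q / x` at `m` and `n`.
      refine ⟨m ^ q / m - (m ^ q / m - n ^ q / n) / (m - n) * m,
        (m ^ q / m - n ^ q / n) / (m - n), ?_, ?_⟩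
      · field_simp; ring
      · field_simp; ring
  have key : ∀ i, hA.eigenvalues i ^ q = α * hA.eigenvalues i + β * hA.eigenvalues i ^ 2 := by
    intro i
    set l := hA.eigenvalues i with hl
    have hv : (hA.eigenvectorBasis i).ofLp ≠ 0 := by
      intro h
      exact hA.eigenvectorBasis.orthonormal.ne_zero i (by ext j; exact congrFun h j)
    have hev : A.mulVec (hA.eigenvectorBasis i).ofLp = (l : ℂ) • (hA.eigenvectorBasis i).ofLp := by
      rw [hA.mulVec_eigenvectorBasis i]; ext j; simp [hl]
    have h := congrArg (fun B => Matrix.mulVec B (hA.eigenvectorBasis i).ofLp) h3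
    simp only [← Matrix.mulVec_mulVec, Matrix.sub_mulVec, Matrix.smul_mulVec, hev,
      Matrix.mulVec_smul, smul_smul, ← sub_smul] at h
    have h4 : ((l : ℂ) * (l * l)) = ((m + n : ℝ) : ℂ) * (l * l) - ((m * n : ℝ) : ℂ) * l :=
      smul_left_injective ℂ hv (by simpa only [mul_assoc] using h)
    have h5 : l * (l * l) = (m + n) * (l * l) - m * n * l := by exact_mod_cast h4
    have h6 : l * ((l - m) * (l - n)) = 0 := by linear_combination h5
    rcases mul_eq_zero.1 h6 with h | h
    · simp [h, Real.zero_rpow hq]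
    rcases mul_eq_zero.1 h with h | h
    · rw [sub_eq_zero.1 h, hm]
    · rw [sub_eq_zero.1 h, hn]
  rw [tracePow_eq_sum hA, Finset.sum_congr rfl fun i _ => key i, Finset.sum_add_distrib,
    ← Finset.mul_sum, ← Finset.mul_sum, sum_eigenvalues_eq_re_trace,
    sum_eigenvalues_sq_eq_re_trace, h1, h2, hm, hn]
  ring

theorem sum_rpow_le_rpow_sum {ι : Type*} (t : Finset ι) {x : ι → ℝ} {q : ℝ} (hq : 1 ≤ q)
    (hx : ∀ i ∈ t, 0 ≤ x i) : ∑ i ∈ t, x i ^ q ≤ (∑ i ∈ t, x i) ^ q := by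
  classical
  induction t using Finset.induction_on with
  | empty => simp [Real.zero_rpow (by linarith : q ≠ 0)]
  | insert a t ha ih =>
    rw [Finset.sum_insert ha, Finset.sum_insert ha]
    have h0 := hx a (Finset.mem_insert_self a t)
    have ht : ∀ i ∈ t, 0 ≤ x i := fun i hi => hx i (Finset.mem_insert_of_mem hi)
    exact (add_le_add_right (ih ht) _).trans
      (Real.add_rpow_le_rpow_add h0 (Finset.sum_nonneg ht) hq)

/-- Among the probability vectors with entries at most `m ≥ 1/2`, the vector `(m, 1 - m)` has the
largest sum of `q`-th powers. -/
theorem sum_rpow_le_of_le {ι : Type*} [Fintype ι] {x : ι → ℝ} {m q : ℝ} (hq : 1 ≤ q)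
    (hx : ∀ i, 0 ≤ x i) (hsum : ∑ i, x i = 1) (hm : 1 / 2 ≤ m) (hm1 : m ≤ 1)
    (hxm : ∀ i, x i ≤ m) : ∑ i, x i ^ q ≤ m ^ q + (1 - m) ^ q := by
  classical
  -- If some `x j` lies in `[1 - m, m]`, merge all other entries by superadditivity; `x j` and `1 -
  -- x j` are then mirrored convex combinations of `m` and `1 - m`. Otherwise every entry is below
  -- `1 - m`, and `x ^ q ≤ x (1 - m) ^ (q - 1)` suffices.
  by_cases h : ∃ j, 1 - m ≤ x j
  · obtain ⟨j, hj⟩ := h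
    have hrest : ∑ i ∈ Finset.univ.erase j, x i = 1 - x j := by
      rw [← hsum, ← Finset.add_sum_erase _ _ (Finset.mem_univ j)]; ring
    have h1 : ∑ i, x i ^ q ≤ x j ^ q + (1 - x j) ^ q := by
      rw [← Finset.add_sum_erase _ _ (Finset.mem_univ j), ← hrest]
      exact add_le_add_right (sum_rpow_le_rpow_sum _ hq fun i _ => hx i) _
    refine h1.trans ?_
    have hc := convexOn_rpow hq
    rcases eq_or_lt_of_le hm with hm' | hm'
    · have : x j = m := le_antisymm (hxm j) (by linarith)
      rw [this]
    set t := (x j - (1 - m)) / (2 * m - 1) with ht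
    have hpos : 0 < 2 * m - 1 := by linarith
    have ht0 : 0 ≤ t := div_nonneg (by linarith) hpos.le
    have ht1 : t ≤ 1 := by rw [ht, div_le_one hpos]; linarith [hxm j]
    have htm : t * (2 * m - 1) = x j - (1 - m) := div_mul_cancel₀ _ hpos.ne'
    have a1 := hc.2 (x := m) (Set.mem_Ici.2 (by linarith)) (y := 1 - m)
      (Set.mem_Ici.2 (by linarith)) ht0 (sub_nonneg.2 ht1) (by ring)
    have a2 := hc.2 (x := 1 - m) (Set.mem_Ici.2 (by linarith)) (y := m)
      (Set.mem_Ici.2 (by linarith)) ht0 (sub_nonneg.2 ht1) (by ring)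
    simp only [smul_eq_mul] at a1 a2
    rw [show t * m + (1 - t) * (1 - m) = x j by linarith] at a1
    rw [show t * (1 - m) + (1 - t) * m = 1 - x j by linarith] at a2
    linarith
  · push Not at h
    have hb : ∀ i, x i ^ q ≤ x i * (1 - m) ^ (q - 1) := by
      intro i
      rcases (hx i).eq_or_lt with h0 | h0
      · rw [← h0, Real.zero_rpow (by linarith)]; simp
      · calc x i ^ q = x i * x i ^ (q - 1) := by
              rw [← Real.rpow_one_add' h0.le (by linarith)]; ring_nf
          _ ≤ _ := by
              gcongr
              exact (h i).le
    have hn : 0 ≤ 1 - m := by linarith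
    have hs : ∀ y : ℝ, 0 ≤ y → y * y ^ (q - 1) = y ^ q := fun y hy => by
      rw [← Real.rpow_one_add' hy (by linarith)]; ring_nf
    calc ∑ i, x i ^ q ≤ ∑ i, x i * (1 - m) ^ (q - 1) := Finset.sum_le_sum fun i _ => hb i
      _ = m * (1 - m) ^ (q - 1) + (1 - m) * (1 - m) ^ (q - 1) := by
          rw [← Finset.sum_mul, hsum]; ring
      _ ≤ m * m ^ (q - 1) + (1 - m) * (1 - m) ^ (q - 1) := by
          gcongr
          linarith
      _ = _ := by rw [hs m (by linarith), hs _ hn]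

end Spectral

/-! ### Overlaps under an isometric involution -/

section Flip

variable {E : Type*} [NormedAddCommGroup E] [InnerProductSpace ℂ E]

/-- The overlap of `φ` and `ψ`, split into parts even and odd under an isometric involution. -/
theorem four_mul_inner_eq_of_involution (F : E ≃ₗᵢ[ℂ] E) (φ ψ : E) :
    4 * inner ℂ φ ψ = inner ℂ (φ - F φ) (ψ - F ψ) + inner ℂ (φ + F φ) (ψ + F ψ) := by
  simp only [inner_add_left, inner_add_right, inner_sub_left, inner_sub_right,
    LinearIsometryEquiv.inner_map_map]
  ring

/-- A unit vector of odd weight `w ≥ 1/2` has small overlap with a vector whose odd part is at most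
as large as its even part. -/
theorem norm_inner_sq_le_of_involution (F : E ≃ₗᵢ[ℂ] E) {φ ψ : E} {w : ℝ}
    (hψ : ‖ψ - F ψ‖ ^ 2 = 4 * w) (hψ' : ‖ψ + F ψ‖ ^ 2 = 4 * (1 - w)) (hw : 1 / 2 ≤ w)
    (hφ : ‖φ - F φ‖ ≤ ‖φ + F φ‖) :
    ‖inner ℂ φ ψ‖ ^ 2 ≤ ‖φ‖ ^ 2 * ((1 + 2 * √(w * (1 - w))) / 2) := by
  have hw1 : 0 ≤ 1 - w := by nlinarith [sq_nonneg ‖ψ + F ψ‖]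
  have hpar : ‖φ + F φ‖ ^ 2 + ‖φ - F φ‖ ^ 2 = 4 * ‖φ‖ ^ 2 := by
    have := parallelogram_law_with_norm ℂ φ (F φ)
    rw [LinearIsometryEquiv.norm_map] at this
    nlinarith
  have h1 : 4 * ‖inner ℂ φ ψ‖ ≤ ‖φ - F φ‖ * (2 * √w) + ‖φ + F φ‖ * (2 * √(1 - w)) := by
    have e1 : ‖ψ - F ψ‖ = 2 * √w := by
      rw [← Real.sqrt_sq (norm_nonneg _), hψ, Real.sqrt_mul (by norm_num)]
      norm_num
    have e2 : ‖ψ + F ψ‖ = 2 * √(1 - w) := by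
      rw [← Real.sqrt_sq (norm_nonneg _), hψ', Real.sqrt_mul (by norm_num)]
      norm_num
    calc 4 * ‖inner ℂ φ ψ‖ = ‖4 * inner ℂ φ ψ‖ := by simp
      _ ≤ ‖φ - F φ‖ * ‖ψ - F ψ‖ + ‖φ + F φ‖ * ‖ψ + F ψ‖ := by
          rw [four_mul_inner_eq_of_involution F]
          exact (norm_add_le _ _).trans (add_le_add (norm_inner_le_norm _ _)
            (norm_inner_le_norm _ _))
      _ = _ := by rw [e1, e2]
  rw [Real.sqrt_mul (by linarith)]
  set a := ‖φ - F φ‖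
  set b := ‖φ + F φ‖
  set x := √w
  set y := √(1 - w)
  have hx : x ^ 2 = w := Real.sq_sqrt (by linarith)
  have hy : y ^ 2 = 1 - w := Real.sq_sqrt hw1
  have hx0 : 0 ≤ x := Real.sqrt_nonneg _
  have hy0 : 0 ≤ y := Real.sqrt_nonneg _
  have ha : 0 ≤ a := norm_nonneg _
  have h2 : (2 * ‖inner ℂ φ ψ‖) ^ 2 ≤ (a * x + b * y) ^ 2 := by
    apply pow_le_pow_left₀ (by positivity)
    linarith
  -- Since `a ≤ b` and `w ≥ 1/2`, this gives `a² w + b² (1 - w) ≤ (a² + b²)/2`. The cross term is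
  -- handled by `2ab ≤ a² + b²`, and `a² + b² = 4‖φ‖²`.
  have h3 : 0 ≤ (b ^ 2 - a ^ 2) * (w - 1 / 2) :=
    mul_nonneg (by nlinarith) (by linarith)
  have h4 : 0 ≤ x * y * (a - b) ^ 2 := by positivity
  have h5 : (a * x + b * y) ^ 2 = a ^ 2 * w + b ^ 2 * (1 - w) + 2 * (x * y) * (a * b) := by
    linear_combination a ^ 2 * hx + b ^ 2 * hy
  have h6 : x * y * (b ^ 2 + a ^ 2) = x * y * (4 * ‖φ‖ ^ 2) := by rw [hpar]
  nlinarith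

end Flip

/-! ### Reduced states, the exchange operator and Werner parameters -/

section States

open scoped ComplexOrder

variable {d : ℕ}

/-- The exchange of the two tensor factors. -/
noncomputable def flip (d : ℕ) : BipVec d ≃ₗᵢ[ℂ] BipVec d :=
  LinearIsometryEquiv.piLpCongrLeft 2 ℂ ℂ (Equiv.prodComm (Fin d) (Fin d))

@[simp] theorem flip_apply (ψ : BipVec d) (p : Fin d × Fin d) : flip d ψ p = ψ p.swap := rfl

/-- The vector `a ⊗ b`. -/
noncomputable def tensor (a b : Fin d → ℂ) : BipVec d := WithLp.toLp 2 fun p => a p.1 * b p.2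

@[simp] theorem tensor_apply (a b : Fin d → ℂ) (p : Fin d × Fin d) :
    tensor a b p = a p.1 * b p.2 := rfl

theorem ketBra_apply (ψ : BipVec d) (a b : Fin d × Fin d) : ketBra ψ a b = ψ a * star (ψ b) := rfl

theorem ketBra_smul (c : ℂ) (ψ : BipVec d) :
    ketBra (c • ψ) = ((‖c‖ ^ 2 : ℝ) : ℂ) • ketBra ψ := by
  ext a b
  have : ((‖c‖ ^ 2 : ℝ) : ℂ) = c * star c := by
    rw [Complex.star_def, Complex.mul_conj, Complex.normSq_eq_norm_sq]
  simp only [ketBra_apply, PiLp.smul_apply, smul_eq_mul, Matrix.smul_apply, this, star_mul']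
  ring

theorem ketBra_add_add_ketBra_sub (φ ψ : BipVec d) :
    ketBra (φ + ψ) + ketBra (φ - ψ) = (2 : ℂ) • (ketBra φ + ketBra ψ) := by
  ext a b
  simp only [ketBra_apply, PiLp.add_apply, PiLp.sub_apply, smul_eq_mul, Matrix.smul_apply,
    Matrix.add_apply, star_add, star_sub]
  ring

theorem trace_ketBra (ψ : BipVec d) : (ketBra ψ).trace = ((‖ψ‖ ^ 2 : ℝ) : ℂ) := by
  rw [EuclideanSpace.norm_sq_eq, Matrix.trace]
  push_cast
  refine Finset.sum_congr rfl fun p _ => ?_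
  rw [Matrix.diag_apply, ketBra_apply, Complex.star_def, Complex.mul_conj,
    Complex.normSq_eq_norm_sq]
  push_cast; rfl

theorem trace_reducedA (ρ : BipOp d) : (reducedA ρ).trace = ρ.trace := by
  simp [Matrix.trace, reducedA, Fintype.sum_prod_type]

/-- The matrix of amplitudes of a vector. -/
def ampMatrix (ψ : BipVec d) : Matrix (Fin d) (Fin d) ℂ := Matrix.of fun i k => ψ (i, k)

theorem reducedA_ketBra (ψ : BipVec d) :
    reducedA (ketBra ψ) = ampMatrix ψ * (ampMatrix ψ).conjTranspose := by
  ext i j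
  simp [reducedA, ketBra_apply, ampMatrix, Matrix.mul_apply]

theorem posSemidef_reducedA_ketBra (ψ : BipVec d) : (reducedA (ketBra ψ)).PosSemidef := by
  rw [reducedA_ketBra]
  exact Matrix.posSemidef_self_mul_conjTranspose _

theorem ampMatrix_add (φ ψ : BipVec d) : ampMatrix (φ + ψ) = ampMatrix φ + ampMatrix ψ := rfl

theorem ampMatrix_smul (c : ℂ) (ψ : BipVec d) : ampMatrix (c • ψ) = c • ampMatrix ψ := rfl

theorem ampMatrix_tensor (a b : Fin d → ℂ) : ampMatrix (tensor a b) = Matrix.vecMulVec a b := rfl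

theorem reducedA_ketBra_tensor {a b : Fin d → ℂ} (hb : star b ⬝ᵥ b = 1) :
    reducedA (ketBra (tensor a b)) = Matrix.vecMulVec a (star a) := by
  rw [reducedA_ketBra, ampMatrix_tensor, Matrix.conjTranspose_vecMulVec,
    Matrix.vecMulVec_mul_vecMulVec, dotProduct_comm, hb, one_smul]

theorem norm_eq_one_of_trace_reducedA {ψ : BipVec d} (h : (reducedA (ketBra ψ)).trace = 1) :
    ‖ψ‖ = 1 := by
  rw [trace_reducedA, trace_ketBra] at h
  have h' : ‖ψ‖ ^ 2 = 1 := by exact_mod_cast h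
  exact (pow_eq_one_iff_of_nonneg (norm_nonneg ψ) two_ne_zero).1 h'

theorem norm_tensor {a b : Fin d → ℂ} (ha : star a ⬝ᵥ a = 1) (hb : star b ⬝ᵥ b = 1) :
    ‖tensor a b‖ = 1 := by
  apply norm_eq_one_of_trace_reducedA
  rw [reducedA_ketBra_tensor hb, Matrix.trace_vecMulVec, dotProduct_comm, ha]

theorem tracePow_tensor {a b : Fin d → ℂ} (ha : star a ⬝ᵥ a = 1) (hb : star b ⬝ᵥ b = 1) {q : ℝ}
    (hq : q ≠ 0) : tracePow (reducedA (ketBra (tensor a b))) q = 1 := by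
  have h := tracePow_eq_of_cubic (posSemidef_reducedA_ketBra (tensor a b)).1 (m := 1) (n := 0) hq
    ?_ ?_ ?_
  · rw [h, Real.zero_rpow hq]; simp
  all_goals
    simp [reducedA_ketBra_tensor hb, Matrix.vecMulVec_mul_vecMulVec, ha, dotProduct_comm a]

theorem reducedA_ketBra_tensor_add {a b : Fin d → ℂ} (ha : star a ⬝ᵥ a = 1)
    (hb : star b ⬝ᵥ b = 1) (hab : star a ⬝ᵥ b = 0) (x y : ℂ) :
    reducedA (ketBra (x • tensor a b + y • tensor b a)) =
      ((‖x‖ ^ 2 : ℝ) : ℂ) • Matrix.vecMulVec a (star a) +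
        ((‖y‖ ^ 2 : ℝ) : ℂ) • Matrix.vecMulVec b (star b) := by
  have hba : star b ⬝ᵥ a = 0 := by rw [Matrix.star_dotProduct, hab, star_zero]
  have hn : ∀ c : ℂ, ((‖c‖ ^ 2 : ℝ) : ℂ) = c * star c := fun c => by
    rw [Complex.star_def, Complex.mul_conj, Complex.normSq_eq_norm_sq]
  rw [reducedA_ketBra, ampMatrix_add, ampMatrix_smul, ampMatrix_smul, ampMatrix_tensor,
    ampMatrix_tensor, hn, hn]
  simp only [Matrix.conjTranspose_add, Matrix.conjTranspose_smul, Matrix.conjTranspose_vecMulVec,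
    add_mul, mul_add, Matrix.smul_mul, Matrix.mul_smul, Matrix.vecMulVec_mul_vecMulVec,
    dotProduct_comm a, dotProduct_comm b, ha, hb, hab, hba, smul_smul]
  simp [mul_comm]

theorem norm_tensor_add {a b : Fin d → ℂ} (ha : star a ⬝ᵥ a = 1)
    (hb : star b ⬝ᵥ b = 1) (hab : star a ⬝ᵥ b = 0) {x y : ℂ} (hxy : ‖x‖ ^ 2 + ‖y‖ ^ 2 = 1) :
    ‖x • tensor a b + y • tensor b a‖ = 1 := by
  apply norm_eq_one_of_trace_reducedA
  rw [reducedA_ketBra_tensor_add ha hb hab, Matrix.trace_add, Matrix.trace_smul, Matrix.trace_smul,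
    Matrix.trace_vecMulVec, Matrix.trace_vecMulVec, dotProduct_comm, ha, dotProduct_comm, hb]
  simp only [smul_eq_mul, mul_one]
  exact_mod_cast hxy

/-- For orthonormal `a`, `b` the vector is in Schmidt form, with weights `‖x‖²` and `‖y‖²`; the
cubic criterion absorbs the remaining zero eigenvalues. -/
theorem tracePow_tensor_add {a b : Fin d → ℂ} (ha : star a ⬝ᵥ a = 1)
    (hb : star b ⬝ᵥ b = 1) (hab : star a ⬝ᵥ b = 0) (x y : ℂ) {q : ℝ} (hq : q ≠ 0) :
    tracePow (reducedA (ketBra (x • tensor a b + y • tensor b a))) q =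
      (‖x‖ ^ 2) ^ q + (‖y‖ ^ 2) ^ q := by
  have hba : star b ⬝ᵥ a = 0 := by rw [Matrix.star_dotProduct, hab, star_zero]
  have h2 : reducedA (ketBra (x • tensor a b + y • tensor b a)) *
      reducedA (ketBra (x • tensor a b + y • tensor b a)) =
      (((‖x‖ ^ 2) ^ 2 : ℝ) : ℂ) • Matrix.vecMulVec a (star a) +
        (((‖y‖ ^ 2) ^ 2 : ℝ) : ℂ) • Matrix.vecMulVec b (star b) := by
    rw [reducedA_ketBra_tensor_add ha hb hab]
    simp only [add_mul, mul_add, Matrix.smul_mul, Matrix.mul_smul, Matrix.vecMulVec_mul_vecMulVec,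
      ha, hb, hab, hba, smul_smul]
    simp [sq, mul_assoc]
  apply tracePow_eq_of_cubic (posSemidef_reducedA_ketBra _).1 hq
  · rw [h2, reducedA_ketBra_tensor_add ha hb hab]
    have e1 : Matrix.vecMulVec a (star a) * Matrix.vecMulVec a (star a) =
        Matrix.vecMulVec a (star a) := by simp [Matrix.vecMulVec_mul_vecMulVec, ha]
    have e2 : Matrix.vecMulVec b (star b) * Matrix.vecMulVec b (star b) =
        Matrix.vecMulVec b (star b) := by simp [Matrix.vecMulVec_mul_vecMulVec, hb]
    have e3 : Matrix.vecMulVec a (star a) * Matrix.vecMulVec b (star b) = 0 := by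
      simp [Matrix.vecMulVec_mul_vecMulVec, hab]
    have e4 : Matrix.vecMulVec b (star b) * Matrix.vecMulVec a (star a) = 0 := by
      simp [Matrix.vecMulVec_mul_vecMulVec, hba]
    simp only [add_mul, mul_add, Matrix.smul_mul, Matrix.mul_smul, e1, e2, e3, e4]
    push_cast
    module
  · rw [reducedA_ketBra_tensor_add ha hb hab, Matrix.trace_add, Matrix.trace_smul,
      Matrix.trace_smul, Matrix.trace_vecMulVec, Matrix.trace_vecMulVec, dotProduct_comm, ha,
      dotProduct_comm, hb]
    simp only [smul_eq_mul, mul_one, Complex.add_re, Complex.ofReal_re]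
  · rw [h2, Matrix.trace_add, Matrix.trace_smul,
      Matrix.trace_smul, Matrix.trace_vecMulVec, Matrix.trace_vecMulVec, dotProduct_comm, ha,
      dotProduct_comm, hb]
    simp only [smul_eq_mul, mul_one, Complex.add_re, Complex.ofReal_re]

/-- Trichotomy of the two indices. It turns sums over `i < k` into sums over all pairs, both for the
projections and for counting pairs. -/
theorem sum_lt_add_swap_add_diag {M : Type*} [AddCommMonoid M] (f : Fin d × Fin d → M) :
    ∑ p : Fin d × Fin d with p.1 < p.2, (f p + f p.swap) + ∑ i, f (i, i) = ∑ p, f p := by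
  have h1 : ∑ p : Fin d × Fin d with p.1 < p.2, f p.swap =
      ∑ p : Fin d × Fin d with p.2 < p.1, f p :=
    Finset.sum_equiv (Equiv.prodComm _ _) (by simp) (by simp)
  have h2 : ∑ i, f (i, i) = ∑ p : Fin d × Fin d with p.1 = p.2, f p := by
    refine Finset.sum_bij (fun i _ => (i, i)) (by simp) (by simp) ?_ (by simp)
    rintro ⟨i, k⟩ h
    simp only [Finset.mem_filter, Finset.mem_univ, true_and] at h
    exact ⟨i, by simp, by rw [h]⟩
  rw [Finset.sum_add_distrib, h1, h2, Finset.sum_filter, Finset.sum_filter, Finset.sum_filter,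
    ← Finset.sum_add_distrib, ← Finset.sum_add_distrib]
  refine Finset.sum_congr rfl fun p _ => ?_
  rcases lt_trichotomy p.1 p.2 with h | h | h
  · simp [h, h.ne, h.not_gt]
  · simp [h]
  · simp [h, h.ne', h.not_gt]

/-- The exchange operator as a matrix. -/
def swapMatrix (d : ℕ) : BipOp d := Matrix.of fun a b => if a = b.swap then 1 else 0

theorem ket_apply (i k : Fin d) (p : Fin d × Fin d) : ket i k p = if p = (i, k) then 1 else 0 := by
  simp [ket]

theorem inv_sqrt_two_sq : ((1 / √2 : ℝ) : ℂ) * ((1 / √2 : ℝ) : ℂ) = 1 / 2 := by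
  rw [← Complex.ofReal_mul, div_mul_div_comm, Real.mul_self_sqrt (by norm_num)]
  norm_num

theorem norm_inv_sqrt_two_sq : ‖((1 / √2 : ℝ) : ℂ)‖ ^ 2 = 1 / 2 := by
  rw [Complex.norm_real, Real.norm_eq_abs, sq_abs, div_pow, Real.sq_sqrt (by norm_num)]
  norm_num

/-- Treats both parities at once: `c = -1` leads to `P⁻ = (1 - F)/2` and `c = 1` to the symmetric
projection `(1 + F)/2`. -/
theorem sum_ketBra_ket_add (c : ℂ) (hc : star c = c) :
    ∑ p : Fin d × Fin d, ketBra (ket p.1 p.2 + c • ket p.2 p.1) =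
      (1 + c * c) • (1 : BipOp d) + (2 * c) • swapMatrix d := by
  ext a b
  have e : ∀ p q : Fin d × Fin d, (q = (p.2, p.1)) = (q.swap = p) := fun p q => by
    rw [eq_iff_iff]; constructor
    · rintro rfl; rfl
    · rintro rfl; rfl
  simp only [Matrix.sum_apply, ketBra_apply, PiLp.add_apply, PiLp.smul_apply, ket_apply,
    smul_eq_mul, star_add, hc, add_mul, mul_add, Finset.sum_add_distrib, Prod.mk.eta, e,
    apply_ite star, star_one, star_zero, mul_ite, mul_one, mul_zero, ite_mul, zero_mul, one_mul,
    Finset.sum_ite_eq, Finset.mem_univ, if_true, Matrix.add_apply, Matrix.smul_apply,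
    Matrix.one_apply, swapMatrix, Matrix.of_apply]
  have e2 : (a.swap = b.swap) = (a = b) := by rw [Prod.swap_inj]
  have e5 : (b = a.swap) = (a = b.swap) := by
    rw [eq_iff_iff]; constructor
    · rintro rfl; simp
    · rintro rfl; simp
  have e6 : (a.swap = b) = (a = b.swap) := by rw [← e5]; exact propext eq_comm
  simp only [e2, e6]
  split_ifs <;> ring

theorem ketBra_phiMinus (i k : Fin d) :
    ketBra (phiMinus i k) = (1 / 2 : ℂ) • ketBra (ket i k + (-1 : ℂ) • ket k i) := by
  rw [phiMinus, ketBra_smul, norm_inv_sqrt_two_sq, neg_one_smul, sub_eq_add_neg]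
  norm_num

theorem ketBra_phiPlus (i k : Fin d) :
    ketBra (phiPlus i k) = (1 / 2 : ℂ) • ketBra (ket i k + (1 : ℂ) • ket k i) := by
  rw [phiPlus, ketBra_smul, norm_inv_sqrt_two_sq, one_smul]
  norm_num

theorem antisymProj_eq : antisymProj d = (1 / 2 : ℂ) • (1 - swapMatrix d) := by
  have h := sum_lt_add_swap_add_diag
    (fun p : Fin d × Fin d => ketBra (ket p.1 p.2 + (-1 : ℂ) • ket p.2 p.1))
  rw [sum_ketBra_ket_add (-1) (by simp)] at h
  -- The factor `4` combines the two orderings of each pair with the normalization `1/2` of `ketBra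
  -- (phiMinus _ _)`.
  have h1 : ∀ p : Fin d × Fin d, ketBra (ket p.1 p.2 + (-1 : ℂ) • ket p.2 p.1) +
      ketBra (ket p.swap.1 p.swap.2 + (-1 : ℂ) • ket p.swap.2 p.swap.1) =
      (4 : ℂ) • ketBra (phiMinus p.1 p.2) := by
    intro p
    have : ket p.swap.1 p.swap.2 + (-1 : ℂ) • ket p.swap.2 p.swap.1 =
      (-1 : ℂ) • (ket p.1 p.2 + (-1 : ℂ) • ket p.2 p.1) := by
      simp only [Prod.fst_swap, Prod.snd_swap]; module
    rw [this, ketBra_smul, ketBra_phiMinus]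
    simp only [norm_neg, norm_one]
    push_cast; module
  have h2 : ∀ i : Fin d, ketBra (ket i i + (-1 : ℂ) • ket i i) = 0 := fun i => by
    ext a b; simp [ketBra_apply]
  rw [Finset.sum_congr rfl fun p _ => h1 p, ← Finset.smul_sum] at h
  simp only [h2, Finset.sum_const_zero, add_zero] at h
  have h3 : antisymProj d = (1 / 4 : ℂ) • ((4 : ℂ) • antisymProj d) := by module
  rw [h3, antisymProj, h]
  module

theorem symProj_eq : symProj d = (1 / 2 : ℂ) • (1 + swapMatrix d) := by
  have h := sum_lt_add_swap_add_diag
    (fun p : Fin d × Fin d => ketBra (ket p.1 p.2 + (1 : ℂ) • ket p.2 p.1))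
  rw [sum_ketBra_ket_add 1 (by simp)] at h
  have h1 : ∀ p : Fin d × Fin d, ketBra (ket p.1 p.2 + (1 : ℂ) • ket p.2 p.1) +
      ketBra (ket p.swap.1 p.swap.2 + (1 : ℂ) • ket p.swap.2 p.swap.1) =
      (4 : ℂ) • ketBra (phiPlus p.1 p.2) := by
    intro p
    have : ket p.swap.1 p.swap.2 + (1 : ℂ) • ket p.swap.2 p.swap.1 =
      (ket p.1 p.2 + (1 : ℂ) • ket p.2 p.1) := by
      simp only [Prod.fst_swap, Prod.snd_swap]; module
    rw [this, ketBra_phiPlus]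
    module
  have h2 : ∀ i : Fin d, ketBra (ket i i + (1 : ℂ) • ket i i) = (4 : ℂ) • ketBra (ket i i) :=
    fun i => by
      ext a b; simp [ketBra_apply]; ring
  rw [Finset.sum_congr rfl fun p _ => h1 p, ← Finset.smul_sum] at h
  simp only [h2, ← Finset.smul_sum] at h
  have h3 : symProj d = (1 / 4 : ℂ) • ((4 : ℂ) • symProj d) := by module
  rw [h3, symProj, smul_add, add_comm, h]
  module

theorem swapMatrix_mul_self : swapMatrix d * swapMatrix d = 1 := by
  ext a b
  simp [swapMatrix, Matrix.mul_apply, Matrix.one_apply]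

theorem trace_swapMatrix : (swapMatrix d).trace = d := by
  have : ∀ p : Fin d × Fin d, (p = p.swap) = (p.1 = p.2) := fun p => by
    rw [eq_iff_iff, Prod.ext_iff]
    simp [eq_comm]
  simp only [Matrix.trace, swapMatrix, Matrix.diag_apply, Matrix.of_apply, this,
    Fintype.sum_prod_type]
  simp

theorem wernerParam_sum {ι : Type*} (t : Finset ι) (p : ι → ℝ) (ρ : ι → BipOp d) :
    wernerParam (∑ i ∈ t, (p i : ℂ) • ρ i) = ∑ i ∈ t, p i * wernerParam (ρ i) := by
  simp [wernerParam, Finset.sum_mul, Matrix.trace_sum]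

theorem wernerParam_wernerState (hd : 2 ≤ d) (w : ℝ) : wernerParam (wernerState d w) = w := by
  have h0 : (d : ℝ) ≠ 0 := by positivity
  have h1 : (d : ℝ) - 1 ≠ 0 := by
    have : (2 : ℝ) ≤ d := by exact_mod_cast hd
    linarith
  have e1 : symProj d * antisymProj d = 0 := by
    rw [symProj_eq, antisymProj_eq]
    simp only [Matrix.smul_mul, Matrix.mul_smul, add_mul, mul_sub, one_mul, mul_one,
      swapMatrix_mul_self]
    module
  have e2 : antisymProj d * antisymProj d = antisymProj d := by
    rw [antisymProj_eq]
    simp only [Matrix.smul_mul, Matrix.mul_smul, sub_mul, mul_sub, one_mul, mul_one,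
      swapMatrix_mul_self]
    module
  have e3 : (antisymProj d).trace = ((d * (d - 1) / 2 : ℝ) : ℂ) := by
    rw [antisymProj_eq, Matrix.trace_smul, Matrix.trace_sub, trace_swapMatrix, Matrix.trace_one]
    simp; ring
  rw [wernerParam, wernerState, add_mul, Matrix.smul_mul, Matrix.smul_mul, e1, e2, smul_zero,
    zero_add, Matrix.trace_smul, e3, smul_eq_mul, ← Complex.ofReal_mul, Complex.ofReal_re]
  field_simp

/-- `(ψ - Fψ)/2` is the odd part `P⁻ψ`; this form feeds the involution estimate. -/
theorem wernerParam_ketBra (ψ : BipVec d) : wernerParam (ketBra ψ) = ‖ψ - flip d ψ‖ ^ 2 / 4 := by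
  have h : (ketBra ψ * swapMatrix d).trace = inner ℂ (flip d ψ) ψ := by
    simp [Matrix.trace, Matrix.mul_apply, swapMatrix, PiLp.inner_apply, ketBra_apply]
  rw [wernerParam, antisymProj_eq, Matrix.mul_smul, mul_sub, mul_one, Matrix.trace_smul,
    Matrix.trace_sub, trace_ketBra, h, @norm_sub_sq ℂ, LinearIsometryEquiv.norm_map,
    ← inner_conj_symm, RCLike.re_to_complex]
  rw [smul_eq_mul, show (1 / 2 : ℂ) = ((1 / 2 : ℝ) : ℂ) by norm_num, Complex.re_ofReal_mul,
    Complex.sub_re, Complex.ofReal_re, Complex.conj_re]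
  ring

theorem wernerParam_ketBra_mem_Icc {ψ : BipVec d} (hψ : ‖ψ‖ = 1) :
    wernerParam (ketBra ψ) ∈ Set.Icc (0 : ℝ) 1 := by
  rw [wernerParam_ketBra]
  refine ⟨by positivity, ?_⟩
  have h := norm_sub_le ψ (flip d ψ)
  rw [LinearIsometryEquiv.norm_map, hψ] at h
  nlinarith [norm_nonneg (ψ - flip d ψ)]

/-- The eigenvalues of the reduced state of a unit vector with Werner parameter `w ≥ 1/2`. -/
theorem eigenvalues_reducedA_le {ψ : BipVec d} (hψ : ‖ψ‖ = 1)
    (hw : 1 / 2 ≤ wernerParam (ketBra ψ)) (j : Fin d) :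
    (posSemidef_reducedA_ketBra ψ).1.eigenvalues j ≤
      (1 + 2 * √(wernerParam (ketBra ψ) * (1 - wernerParam (ketBra ψ)))) / 2 := by
  set w := wernerParam (ketBra ψ) with hwdef
  set hA : (reducedA (ketBra ψ)).IsHermitian := (posSemidef_reducedA_ketBra ψ).1
  set v : Fin d → ℂ := (hA.eigenvectorBasis j).ofLp with hv
  have hvv : star v ⬝ᵥ v = 1 := by
    have := hA.eigenvectorBasis.orthonormal.1 j
    have h2 := inner_self_eq_norm_sq_to_K (𝕜 := ℂ) (hA.eigenvectorBasis j)
    rw [this, EuclideanSpace.inner_eq_star_dotProduct] at h2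
    rw [dotProduct_comm]; simpa using h2
  -- Contracting `ψ` with the eigenvector `v` gives the unnormalized product vector `φ = v ⊗ c`, for
  -- which `⟨φ, ψ⟩ = ‖φ‖² = L`. The overlap bound becomes `L² ≤ L (1 + G)/2`.
  set c : Fin d → ℂ := Matrix.vecMul (star v) (ampMatrix ψ) with hc
  set φ := tensor v c with hφ
  set L := hA.eigenvalues j with hL
  have hcc : star c ⬝ᵥ c = (L : ℂ) := by
    have h1 : Matrix.mulVec (reducedA (ketBra ψ)) v = (L : ℂ) • v := by
      rw [hv, hA.mulVec_eigenvectorBasis j]; ext j; simp [hL]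
    have h2 : star v ⬝ᵥ Matrix.mulVec (reducedA (ketBra ψ)) v = (L : ℂ) := by
      rw [h1, dotProduct_smul, hvv]; simp
    rw [← h2, reducedA_ketBra, ← Matrix.mulVec_mulVec, Matrix.dotProduct_mulVec, ← hc,
      dotProduct_comm, hc, Matrix.star_vecMul, star_star]
  have hinner : inner ℂ φ ψ = (L : ℂ) := by
    rw [← hcc, PiLp.inner_apply, Fintype.sum_prod_type, Finset.sum_comm]
    refine Finset.sum_congr rfl fun k _ => ?_
    have hck : c k = ∑ i, star (v i) * ψ (i, k) := rfl
    have h1 : star c k * c k = star (c k) * ∑ i, star (v i) * ψ (i, k) := by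
      rw [← hck, Pi.star_apply]
    rw [h1, Finset.mul_sum]
    refine Finset.sum_congr rfl fun i _ => ?_
    simp only [hφ, tensor_apply, RCLike.inner_apply, map_mul, Complex.star_def]
    ring
  have hnorm : ‖φ‖ ^ 2 = L := by
    have h1 := trace_ketBra φ
    rw [← trace_reducedA, reducedA_ketBra, hφ, ampMatrix_tensor, Matrix.conjTranspose_vecMulVec,
      Matrix.vecMulVec_mul_vecMulVec, dotProduct_comm c, hcc, Matrix.trace_vecMulVec,
      dotProduct_smul, dotProduct_comm, hvv] at h1
    simp only [smul_eq_mul, mul_one] at h1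
    exact_mod_cast h1.symm
  have hflip : inner ℂ φ (flip d φ) = ((‖star v ⬝ᵥ c‖ ^ 2 : ℝ) : ℂ) := by
    rw [← Complex.normSq_eq_norm_sq, ← Complex.mul_conj, PiLp.inner_apply, Fintype.sum_prod_type,
      dotProduct, map_sum, Finset.sum_mul_sum]
    refine Finset.sum_congr rfl fun i _ => Finset.sum_congr rfl fun k _ => ?_
    simp [hφ]
    ring
  -- `⟨φ, Fφ⟩` is a squared modulus, hence nonnegative: the odd part of a product vector does not
  -- exceed its even part.
  have hsub : ‖φ - flip d φ‖ ≤ ‖φ + flip d φ‖ := by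
    apply le_of_sq_le_sq _ (norm_nonneg _)
    rw [@norm_sub_sq ℂ, @norm_add_sq ℂ, hflip, RCLike.re_to_complex, Complex.ofReal_re]
    nlinarith [sq_nonneg ‖star v ⬝ᵥ c‖]
  have hm : ‖ψ - flip d ψ‖ ^ 2 = 4 * w := by rw [hwdef, wernerParam_ketBra]; ring
  have hp : ‖ψ + flip d ψ‖ ^ 2 = 4 * (1 - w) := by
    have := parallelogram_law_with_norm ℂ ψ (flip d ψ)
    rw [LinearIsometryEquiv.norm_map, hψ] at this
    nlinarith
  have key := norm_inner_sq_le_of_involution (flip d) hm hp hw hsub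
  rw [hinner, hnorm, Complex.norm_real, Real.norm_eq_abs, sq_abs] at key
  have hL0 : 0 ≤ L := (posSemidef_reducedA_ketBra ψ).eigenvalues_nonneg j
  rcases hL0.eq_or_lt with h0 | h0
  · rw [← h0]; positivity
  · exact le_of_mul_le_mul_left (by linarith) h0

end States

/-! ### Decomposition values and optimal pure states -/

section Decompositions

variable {d : ℕ} {q s : ℝ}

theorem coe_smul_eq_smul (x : ℝ) (ρ : BipOp d) : (x : ℂ) • ρ = x • ρ := by
  ext a b
  simp

theorem mem_decompositionValues_of_fintype {ι : Type*} [Fintype ι] {ρ : BipOp d} {p : ι → ℝ}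
    {ψ : ι → BipVec d} (hp : ∀ i, 0 ≤ p i) (hp1 : ∑ i, p i = 1) (hψ : ∀ i, ‖ψ i‖ = 1)
    (hρ : ρ = ∑ i, (p i : ℂ) • ketBra (ψ i)) :
    ∑ i, p i * pureConcurrence q s (ψ i) ∈ decompositionValues q s ρ := by
  let e := (Fintype.equivFin ι).symm
  refine ⟨Fintype.card ι, p ∘ e, ψ ∘ e, fun i => hp _, ?_, fun i => hψ _, ?_, ?_⟩
  · rw [← hp1]; exact e.sum_comp p
  · rw [hρ]; exact (e.sum_comp fun i => (p i : ℂ) • ketBra (ψ i)).symm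
  · exact (e.sum_comp fun i => p i * pureConcurrence q s (ψ i)).symm

theorem pureConcurrence_mem_decompositionValues {ψ : BipVec d} (hψ : ‖ψ‖ = 1) :
    pureConcurrence q s ψ ∈ decompositionValues q s (ketBra ψ) := by
  have h := mem_decompositionValues_of_fintype (q := q) (s := s) (ι := Unit) (ρ := ketBra ψ)
    (p := fun _ => 1) (ψ := fun _ => ψ) (by simp) (by simp) (by simp [hψ]) (by simp)
  simpa using h

theorem decompositionValues_convex_comb {ρ σ : BipOp d} {x y t u : ℝ}
    (hx : x ∈ decompositionValues q s ρ) (hy : y ∈ decompositionValues q s σ) (ht : 0 ≤ t)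
    (hu : 0 ≤ u) (htu : t + u = 1) :
    t * x + u * y ∈ decompositionValues q s (t • ρ + u • σ) := by
  obtain ⟨n, p, ψ, hp, hp1, hψ, hρ, rfl⟩ := hx
  obtain ⟨n', p', ψ', hp', hp1', hψ', hσ, rfl⟩ := hy
  have h := mem_decompositionValues_of_fintype (q := q) (s := s) (ι := Fin n ⊕ Fin n')
    (ρ := t • ρ + u • σ) (p := Sum.elim (fun i => t * p i) (fun i => u * p' i))
    (ψ := Sum.elim ψ ψ') ?_ ?_ ?_ ?_
  · simpa [Finset.mul_sum, mul_assoc] using h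
  · rintro (i | i)
    exacts [mul_nonneg ht (hp i), mul_nonneg hu (hp' i)]
  · simp [← Finset.mul_sum, hp1, hp1', htu]
  · rintro (i | i)
    exacts [hψ i, hψ' i]
  · simp [hρ, hσ, Finset.smul_sum, mul_smul]

/-- Mixing two decompositions with the same average `c` keeps the average. Twirling thus reduces to
membership in a convex set `K` containing suitable pure states. -/
theorem convex_setOf_mem_decompositionValues (q s c : ℝ) :
    Convex ℝ {ρ : BipOp d | c ∈ decompositionValues q s ρ} := by
  intro ρ hρ σ hσ t u ht hu htu
  have h := decompositionValues_convex_comb hρ hσ ht hu htu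
  rwa [← add_mul, htu, one_mul] at h

theorem pureConcurrence_eq (hq : 1 < q) (hqs : 1 ≤ q * s) (ψ : BipVec d) :
    pureConcurrence q s ψ = 1 - tracePow (reducedA (ketBra ψ)) q ^ s := by
  rw [pureConcurrence, signFactor, if_pos ⟨hq.le, hqs⟩, one_mul]

/-- The value `1 - (((1 + G) / 2) ^ q + ((1 - G) / 2) ^ q) ^ s` with `G = 2 √(w (1 - w))`. -/
noncomputable def xiValue (q s w : ℝ) : ℝ :=
  1 - (((1 + 2 * √(w * (1 - w))) / 2) ^ q + ((1 - 2 * √(w * (1 - w))) / 2) ^ q) ^ s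

theorem two_mul_sqrt_le_one (w : ℝ) : 2 * √(w * (1 - w)) ≤ 1 := by
  have : √(w * (1 - w)) ≤ 1 / 2 := by
    rw [Real.sqrt_le_left (by norm_num)]
    nlinarith [sq_nonneg (w - 1 / 2)]
  linarith

theorem tracePow_reducedA_nonneg (ψ : BipVec d) (q : ℝ) :
    0 ≤ tracePow (reducedA (ketBra ψ)) q := by
  rw [tracePow_eq_sum (posSemidef_reducedA_ketBra ψ).1]
  exact Finset.sum_nonneg fun i _ =>
    Real.rpow_nonneg ((posSemidef_reducedA_ketBra ψ).eigenvalues_nonneg i) _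

theorem sum_eigenvalues_reducedA {ψ : BipVec d} (hψ : ‖ψ‖ = 1) :
    ∑ i, (posSemidef_reducedA_ketBra ψ).1.eigenvalues i = 1 := by
  rw [sum_eigenvalues_eq_re_trace, trace_reducedA, trace_ketBra, hψ]
  simp

theorem pureConcurrence_nonneg (hq : 1 < q) (hqs : 1 ≤ q * s) {ψ : BipVec d} (hψ : ‖ψ‖ = 1) :
    0 ≤ pureConcurrence q s ψ := by
  have hs : 0 < s := by
    by_contra h
    nlinarith
  rw [pureConcurrence_eq hq hqs, sub_nonneg]
  apply Real.rpow_le_one (tracePow_reducedA_nonneg ψ q) _ hs.le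
  have hpos := (posSemidef_reducedA_ketBra ψ).eigenvalues_nonneg
  rw [tracePow_eq_sum (posSemidef_reducedA_ketBra ψ).1]
  refine (sum_rpow_le_rpow_sum Finset.univ hq.le fun i _ => hpos i).trans ?_
  rw [sum_eigenvalues_reducedA hψ, Real.one_rpow]

theorem xiValue_le_pureConcurrence (hq : 1 < q) (hqs : 1 ≤ q * s) {ψ : BipVec d} (hψ : ‖ψ‖ = 1)
    (hw : 1 / 2 ≤ wernerParam (ketBra ψ)) :
    xiValue q s (wernerParam (ketBra ψ)) ≤ pureConcurrence q s ψ := by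
  have hs : 0 < s := by
    by_contra h
    nlinarith
  rw [pureConcurrence_eq hq hqs, xiValue]
  apply sub_le_sub_left
  apply Real.rpow_le_rpow (tracePow_reducedA_nonneg ψ q) _ hs.le
  rw [tracePow_eq_sum (posSemidef_reducedA_ketBra ψ).1]
  set w := wernerParam (ketBra ψ)
  have h := sum_rpow_le_of_le hq.le (posSemidef_reducedA_ketBra ψ).eigenvalues_nonneg
    (sum_eigenvalues_reducedA hψ) (m := (1 + 2 * √(w * (1 - w))) / 2)
    (by linarith [Real.sqrt_nonneg (w * (1 - w))]) (by linarith [two_mul_sqrt_le_one w])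
    (eigenvalues_reducedA_le hψ hw)
  rwa [show 1 - (1 + 2 * √(w * (1 - w))) / 2 = (1 - 2 * √(w * (1 - w))) / 2 by ring] at h

/-- `(a ⊗ b - b ⊗ a) / √2`. -/
noncomputable def antisymTensor (a b : Fin d → ℂ) : BipVec d :=
  ((1 / √2 : ℝ) : ℂ) • (tensor a b - tensor b a)

/-- `(a ⊗ b + b ⊗ a) / √2`. -/
noncomputable def symTensor (a b : Fin d → ℂ) : BipVec d :=
  ((1 / √2 : ℝ) : ℂ) • (tensor a b + tensor b a)

/-- A vector with Werner parameter `w` in the span of `a ⊗ b` and `b ⊗ a`. -/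
noncomputable def optimalVec (w : ℝ) (a b : Fin d → ℂ) : BipVec d :=
  ((√(1 - w) : ℝ) : ℂ) • symTensor a b + ((√w : ℝ) : ℂ) • antisymTensor a b

theorem optimalVec_eq (w : ℝ) (a b : Fin d → ℂ) :
    optimalVec w a b = (((√(1 - w) + √w) / √2 : ℝ) : ℂ) • tensor a b +
      (((√(1 - w) - √w) / √2 : ℝ) : ℂ) • tensor b a := by
  rw [optimalVec, symTensor, antisymTensor]
  push_cast
  module

theorem norm_sq_coeffs {w : ℝ} (hw0 : 0 ≤ w) (hw1 : w ≤ 1) :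
    ‖(((√(1 - w) + √w) / √2 : ℝ) : ℂ)‖ ^ 2 = (1 + 2 * √(w * (1 - w))) / 2 ∧
      ‖(((√(1 - w) - √w) / √2 : ℝ) : ℂ)‖ ^ 2 = (1 - 2 * √(w * (1 - w))) / 2 := by
  have h1 : √w ^ 2 = w := Real.sq_sqrt hw0
  have h2 : √(1 - w) ^ 2 = 1 - w := Real.sq_sqrt (by linarith)
  rw [Complex.norm_real, Complex.norm_real, Real.norm_eq_abs, Real.norm_eq_abs, sq_abs, sq_abs,
    div_pow, div_pow, Real.sq_sqrt (by norm_num : (0 : ℝ) ≤ 2), Real.sqrt_mul hw0]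
  constructor
  · linear_combination (h1 + h2) / 2
  · linear_combination (h1 + h2) / 2

theorem norm_optimalVec {a b : Fin d → ℂ} (ha : star a ⬝ᵥ a = 1)
    (hb : star b ⬝ᵥ b = 1) (hab : star a ⬝ᵥ b = 0) {w : ℝ} (hw0 : 0 ≤ w) (hw1 : w ≤ 1) :
    ‖optimalVec w a b‖ = 1 := by
  rw [optimalVec_eq]
  apply norm_tensor_add ha hb hab
  rw [(norm_sq_coeffs hw0 hw1).1, (norm_sq_coeffs hw0 hw1).2]
  ring

theorem pureConcurrence_optimalVec (hq : 1 < q) (hqs : 1 ≤ q * s) {a b : Fin d → ℂ}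
    (ha : star a ⬝ᵥ a = 1) (hb : star b ⬝ᵥ b = 1) (hab : star a ⬝ᵥ b = 0) {w : ℝ} (hw0 : 0 ≤ w)
    (hw1 : w ≤ 1) : pureConcurrence q s (optimalVec w a b) = xiValue q s w := by
  rw [pureConcurrence_eq hq hqs, optimalVec_eq, tracePow_tensor_add ha hb hab _ _ (by linarith),
    (norm_sq_coeffs hw0 hw1).1, (norm_sq_coeffs hw0 hw1).2, xiValue]

theorem pureConcurrence_tensor (hq : 1 < q) (hqs : 1 ≤ q * s) {a b : Fin d → ℂ}
    (ha : star a ⬝ᵥ a = 1) (hb : star b ⬝ᵥ b = 1) :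
    pureConcurrence q s (tensor a b) = 0 := by
  rw [pureConcurrence_eq hq hqs, tracePow_tensor ha hb (by linarith), Real.one_rpow, sub_self]

theorem flip_tensor (a b : Fin d → ℂ) : flip d (tensor a b) = tensor b a := by
  ext p
  simp [mul_comm]

theorem norm_antisymTensor {a b : Fin d → ℂ} (ha : star a ⬝ᵥ a = 1)
    (hb : star b ⬝ᵥ b = 1) (hab : star a ⬝ᵥ b = 0) : ‖antisymTensor a b‖ = 1 := by
  have h : antisymTensor a b = ((1 / √2 : ℝ) : ℂ) • tensor a b +
      (-((1 / √2 : ℝ) : ℂ)) • tensor b a := by rw [antisymTensor]; module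
  rw [h]
  apply norm_tensor_add ha hb hab
  rw [norm_neg, norm_inv_sqrt_two_sq]
  norm_num

theorem wernerParam_eq_of_sub_flip {a b : Fin d → ℂ} (ha : star a ⬝ᵥ a = 1)
    (hb : star b ⬝ᵥ b = 1) (hab : star a ⬝ᵥ b = 0) {w : ℝ} (hw : 0 ≤ w) {ψ : BipVec d}
    (hψ : ψ - flip d ψ = ((2 * √w : ℝ) : ℂ) • antisymTensor a b) :
    wernerParam (ketBra ψ) = w := by
  rw [wernerParam_ketBra, hψ, norm_smul, norm_antisymTensor ha hb hab, Complex.norm_real,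
    Real.norm_eq_abs, mul_one, sq_abs, mul_pow, Real.sq_sqrt hw]
  ring

theorem wernerParam_optimalVec {a b : Fin d → ℂ} (ha : star a ⬝ᵥ a = 1)
    (hb : star b ⬝ᵥ b = 1) (hab : star a ⬝ᵥ b = 0) {w : ℝ} (hw : 0 ≤ w) :
    wernerParam (ketBra (optimalVec w a b)) = w := by
  apply wernerParam_eq_of_sub_flip ha hb hab hw
  simp only [optimalVec, symTensor, antisymTensor, map_add, map_sub, map_smul, flip_tensor]
  push_cast
  module

theorem ket_eq_tensor (i k : Fin d) : ket i k = tensor (Pi.single i 1) (Pi.single k 1) := by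
  ext p
  simp only [ket_apply, tensor_apply, Pi.single_apply, Prod.ext_iff]
  split_ifs <;> simp_all

theorem phiMinus_eq (i k : Fin d) :
    phiMinus i k = antisymTensor (Pi.single i 1) (Pi.single k 1) := by
  rw [phiMinus, antisymTensor, ket_eq_tensor, ket_eq_tensor]

theorem phiPlus_eq (i k : Fin d) :
    phiPlus i k = symTensor (Pi.single i 1) (Pi.single k 1) := by
  rw [phiPlus, symTensor, ket_eq_tensor, ket_eq_tensor]

theorem star_single_dotProduct_self (i : Fin d) :
    star (Pi.single i (1 : ℂ)) ⬝ᵥ Pi.single i (1 : ℂ) = 1 := by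
  simp

theorem star_single_dotProduct_of_ne {i k : Fin d} (h : i ≠ k) :
    star (Pi.single i (1 : ℂ)) ⬝ᵥ Pi.single k (1 : ℂ) = 0 := by
  simp [h]

theorem isLeast_wernerPureValues_of_half_le (hd : 2 ≤ d) (hq : 1 < q) (hqs : 1 ≤ q * s) {w : ℝ}
    (hw : 1 / 2 ≤ w) (hw1 : w ≤ 1) : IsLeast (wernerPureValues d q s w) (xiValue q s w) := by
  have h01 : (⟨0, by omega⟩ : Fin d) ≠ ⟨1, by omega⟩ := by simp
  have ha := star_single_dotProduct_self (⟨0, by omega⟩ : Fin d)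
  have hb := star_single_dotProduct_self (⟨1, by omega⟩ : Fin d)
  have hab := star_single_dotProduct_of_ne h01
  have hw0 : 0 ≤ w := by linarith
  refine ⟨⟨_, norm_optimalVec ha hb hab hw0 hw1, wernerParam_optimalVec ha hb hab hw0,
    (pureConcurrence_optimalVec hq hqs ha hb hab hw0 hw1).symm⟩, ?_⟩
  rintro _ ⟨ψ, hψ, rfl, rfl⟩
  exact xiValue_le_pureConcurrence hq hqs hψ hw

theorem isLeast_wernerPureValues_of_le_half (hd : 2 ≤ d) (hq : 1 < q) (hqs : 1 ≤ q * s) {w : ℝ}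
    (hw0 : 0 ≤ w) (hw : w ≤ 1 / 2) : IsLeast (wernerPureValues d q s w) 0 := by
  have h01 : (⟨0, by omega⟩ : Fin d) ≠ ⟨1, by omega⟩ := by simp
  set e : Fin d → ℂ := Pi.single ⟨0, by omega⟩ 1
  set f : Fin d → ℂ := Pi.single ⟨1, by omega⟩ 1
  have he : star e ⬝ᵥ e = 1 := star_single_dotProduct_self _
  have hf : star f ⬝ᵥ f = 1 := star_single_dotProduct_self _
  have hef : star e ⬝ᵥ f = 0 := star_single_dotProduct_of_ne h01
  have hfe : star f ⬝ᵥ e = 0 := star_single_dotProduct_of_ne h01.symm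
  -- For `ψ = e ⊗ (x e + y f)` one has `ψ - Fψ = y (e ⊗ f - f ⊗ e)`, so parameter `w` requires `|y|²
  -- = 2w`; normalization of `x` is where `w ≤ 1/2` enters.
  set x : ℂ := ((√(1 - 2 * w) : ℝ) : ℂ) with hx
  set y : ℂ := ((√2 * √w : ℝ) : ℂ) with hy
  have hxy : star x * x + star y * y = 1 := by
    rw [hx, hy, Complex.star_def, Complex.conj_ofReal, Complex.conj_ofReal,
      ← Complex.ofReal_mul, ← Complex.ofReal_mul, ← Complex.ofReal_add, ← sq, ← sq, mul_pow,
      Real.sq_sqrt (by linarith), Real.sq_sqrt hw0, Real.sq_sqrt (by norm_num)]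
    norm_num
  have hv : star (x • e + y • f) ⬝ᵥ (x • e + y • f) = 1 := by
    simp only [star_add, star_smul, add_dotProduct, dotProduct_add, smul_dotProduct,
      dotProduct_smul, he, hf, hef, hfe, smul_eq_mul]
    linear_combination hxy
  refine ⟨⟨tensor e (x • e + y • f), norm_tensor he hv, ?_,
    (pureConcurrence_tensor hq hqs he hv).symm⟩, ?_⟩
  · apply wernerParam_eq_of_sub_flip he hf hef hw0
    rw [flip_tensor]
    ext p
    have h2 : (√2 : ℂ) = ((1 / √2 : ℝ) : ℂ) * 2 := by
      rw [← Complex.ofReal_ofNat, ← Complex.ofReal_mul, Complex.ofReal_inj]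
      have h3 : √2 * √2 = 2 := Real.mul_self_sqrt (by norm_num)
      have : √2 ≠ 0 := by positivity
      field_simp
      linarith
    simp only [PiLp.sub_apply, PiLp.smul_apply, tensor_apply, antisymTensor, smul_eq_mul,
      Pi.add_apply, Pi.smul_apply, hy, Complex.ofReal_mul, h2]
    push_cast
    ring
  · rintro _ ⟨ψ, hψ, -, rfl⟩
    exact pureConcurrence_nonneg hq hqs hψ

/-- Here `G = 1`, so the optimal vectors are product vectors and the two regimes of `ξ` meet. -/
theorem xiValue_half (hq : 1 < q) : xiValue q s (1 / 2) = 0 := by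
  have : √(1 / 2 * (1 - 1 / 2) : ℝ) = 1 / 2 := by
    rw [show (1 / 2 * (1 - 1 / 2) : ℝ) = (1 / 2) ^ 2 by norm_num, Real.sqrt_sq (by norm_num)]
  rw [xiValue, this]
  norm_num
  rw [Real.zero_rpow (by linarith)]
  simp

end Decompositions

/-! ### Werner states as finite mixtures of optimal states -/

section Twirl

variable {d : ℕ} {q s : ℝ}

/-- Exchanging `a` and `b` flips only the sign of the antisymmetric component, so averaging the two
states removes the cross terms. -/
theorem antisym_add_sym_mem {K : Set (BipOp d)} (hK : Convex ℝ K) {w : ℝ} (hw0 : 0 ≤ w)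
    (hw1 : w ≤ 1) {a b : Fin d → ℂ} (hab : ketBra (optimalVec w a b) ∈ K)
    (hba : ketBra (optimalVec w b a) ∈ K) :
    w • ketBra (antisymTensor a b) + (1 - w) • ketBra (symTensor a b) ∈ K := by
  have h := hK hab hba (by norm_num : (0 : ℝ) ≤ 1 / 2) (by norm_num : (0 : ℝ) ≤ 1 / 2)
    (by norm_num)
  have h1 : optimalVec w b a = ((√(1 - w) : ℝ) : ℂ) • symTensor a b -
      ((√w : ℝ) : ℂ) • antisymTensor a b := by
    rw [optimalVec, symTensor, symTensor, antisymTensor, antisymTensor]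
    module
  rw [← smul_add, h1, optimalVec, ketBra_add_add_ketBra_sub, ketBra_smul, ketBra_smul,
    Complex.norm_real, Complex.norm_real, Real.norm_eq_abs, Real.norm_eq_abs, sq_abs, sq_abs,
    Real.sq_sqrt hw0, Real.sq_sqrt (by linarith), coe_smul_eq_smul, coe_smul_eq_smul,
    show (2 : ℂ) = ((2 : ℝ) : ℂ) by norm_num, coe_smul_eq_smul, smul_smul] at h
  convert h using 1
  module

/-- The vector `(u + c v) / √2`. -/
noncomputable def halfSum (c : ℂ) (u v : Fin d → ℂ) : Fin d → ℂ :=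
  ((1 / √2 : ℝ) : ℂ) • (u + c • v)

theorem star_halfSum_dotProduct_halfSum {u v : Fin d → ℂ} (hu : star u ⬝ᵥ u = 1)
    (hv : star v ⬝ᵥ v = 1) (huv : star u ⬝ᵥ v = 0) (c e : ℂ) :
    star (halfSum c u v) ⬝ᵥ halfSum e u v = (1 + star c * e) / 2 := by
  have hvu : star v ⬝ᵥ u = 0 := by rw [Matrix.star_dotProduct, huv, star_zero]
  have hr : star ((1 / √2 : ℝ) : ℂ) = ((1 / √2 : ℝ) : ℂ) := Complex.conj_ofReal _
  simp only [halfSum, star_add, star_smul, add_dotProduct, dotProduct_add, smul_dotProduct,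
    dotProduct_smul, hu, hv, huv, hvu, smul_eq_mul, hr]
  linear_combination (1 + star c * e) * inv_sqrt_two_sq

theorem antisymTensor_halfSum (c : ℂ) (u v : Fin d → ℂ) :
    antisymTensor (halfSum c u v) (halfSum (-c) u v) = (-c) • antisymTensor u v := by
  ext p
  simp only [antisymTensor, halfSum, PiLp.smul_apply, PiLp.sub_apply, tensor_apply, Pi.smul_apply,
    Pi.add_apply, smul_eq_mul]
  linear_combination (-2 * c * ((1 / √2 : ℝ) : ℂ) * (u p.1 * v p.2 - v p.1 * u p.2)) *
    inv_sqrt_two_sq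

theorem symTensor_halfSum (c : ℂ) (u v : Fin d → ℂ) :
    symTensor (halfSum c u v) (halfSum (-c) u v) =
      ((1 / √2 : ℝ) : ℂ) • (tensor u u - (c * c) • tensor v v) := by
  ext p
  simp only [symTensor, halfSum, PiLp.smul_apply, PiLp.add_apply, PiLp.sub_apply, tensor_apply,
    Pi.smul_apply, Pi.add_apply, smul_eq_mul]
  linear_combination (2 * ((1 / √2 : ℝ) : ℂ) * (u p.1 * u p.2 - c * c * v p.1 * v p.2)) *
    inv_sqrt_two_sq

/-- Applied to the rotated pair `(u ± c v)/√2`, the previous mixture keeps the antisymmetric part up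
to a phase, while the symmetric part becomes `(u ⊗ u - c² v ⊗ v)/√2`. -/
theorem antisym_add_diag_mem {K : Set (BipOp d)} (hK : Convex ℝ K) {w : ℝ} (hw0 : 0 ≤ w)
    (hw1 : w ≤ 1) (hKopt : ∀ a b : Fin d → ℂ, star a ⬝ᵥ a = 1 → star b ⬝ᵥ b = 1 →
      star a ⬝ᵥ b = 0 → ketBra (optimalVec w a b) ∈ K)
    {u v : Fin d → ℂ} (hu : star u ⬝ᵥ u = 1) (hv : star v ⬝ᵥ v = 1) (huv : star u ⬝ᵥ v = 0) :
    w • ketBra (antisymTensor u v) +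
      ((1 - w) / 2) • (ketBra (tensor u u) + ketBra (tensor v v)) ∈ K := by
  have key : ∀ c : ℂ, star c * c = 1 → w • ketBra (antisymTensor u v) +
      ((1 - w) / 2) • ketBra (tensor u u - (c * c) • tensor v v) ∈ K := by
    intro c hc
    have h1 : star (halfSum c u v) ⬝ᵥ halfSum c u v = 1 := by
      rw [star_halfSum_dotProduct_halfSum hu hv huv, hc]; norm_num
    have h2 : star (halfSum (-c) u v) ⬝ᵥ halfSum (-c) u v = 1 := by
      rw [star_halfSum_dotProduct_halfSum hu hv huv, star_neg, neg_mul_neg, hc]; norm_num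
    have h3 : star (halfSum c u v) ⬝ᵥ halfSum (-c) u v = 0 := by
      rw [star_halfSum_dotProduct_halfSum hu hv huv, mul_neg, hc]; norm_num
    have h4 : star (halfSum (-c) u v) ⬝ᵥ halfSum c u v = 0 := by
      rw [star_halfSum_dotProduct_halfSum hu hv huv, star_neg, neg_mul, hc]; norm_num
    have h := antisym_add_sym_mem hK hw0 hw1 (hKopt _ _ h1 h2 h3) (hKopt _ _ h2 h1 h4)
    have hn : ‖-c‖ ^ 2 = 1 := by
      have : ((‖c‖ ^ 2 : ℝ) : ℂ) = 1 := by
        rw [← hc, Complex.star_def, mul_comm, Complex.mul_conj, Complex.normSq_eq_norm_sq]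
      rw [norm_neg]
      exact_mod_cast this
    rw [antisymTensor_halfSum, symTensor_halfSum, ketBra_smul, ketBra_smul, hn,
      norm_inv_sqrt_two_sq, coe_smul_eq_smul, coe_smul_eq_smul, one_smul, smul_smul] at h
    convert h using 3
    ring
  -- `c = 1` and `c = i` give `c² = ±1`; averaging cancels the coherence between `u ⊗ u` and `v ⊗
  -- v`.
  have h := hK (key 1 (by simp)) (key Complex.I (by simp)) (by norm_num : (0 : ℝ) ≤ 1 / 2)
    (by norm_num : (0 : ℝ) ≤ 1 / 2) (by norm_num)
  have h2 := ketBra_add_add_ketBra_sub (tensor u u) (tensor v v)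
  rw [show (2 : ℂ) = ((2 : ℝ) : ℂ) by norm_num, coe_smul_eq_smul] at h2
  rw [Complex.I_mul_I, neg_one_smul, sub_neg_eq_add, one_mul, one_smul] at h
  convert h using 1
  have h3 : ketBra (tensor u u) + ketBra (tensor v v) = (1 / 2 : ℝ) •
      (ketBra (tensor u u + tensor v v) + ketBra (tensor u u - tensor v v)) := by
    rw [h2, smul_smul]; norm_num
  rw [h3]
  module

theorem wernerState_eq (w : ℝ) : wernerState d w =
    (2 * (1 - w) / (d * (d + 1))) • symProj d + (2 * w / (d * (d - 1))) • antisymProj d := by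
  rw [wernerState, coe_smul_eq_smul, coe_smul_eq_smul]

theorem wernerState_mem_of_convex (hd : 2 ≤ d) {K : Set (BipOp d)} (hK : Convex ℝ K) {w : ℝ}
    (hw0 : 0 ≤ w) (hw1 : w ≤ 1) (hKopt : ∀ a b : Fin d → ℂ, star a ⬝ᵥ a = 1 → star b ⬝ᵥ b = 1 →
      star a ⬝ᵥ b = 0 → ketBra (optimalVec w a b) ∈ K) : wernerState d w ∈ K := by
  have hd' : (2 : ℝ) ≤ d := by exact_mod_cast hd
  have hd0 : (d : ℝ) ≠ 0 := by positivity
  have hd1 : (d : ℝ) - 1 ≠ 0 := by linarith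
  have hd2 : (d : ℝ) + 1 ≠ 0 := by positivity
  -- Each `|ii⟩` occurs in `d - 1` pairs but each `Φ⁺` in only one. The weights `(d - 1)/(d + 1)`
  -- and `2/(d + 1)` equalize their coefficients after the uniform average over the `d (d - 1)/2`
  -- pairs.
  set T : Fin d × Fin d → BipOp d := fun p =>
    (((d : ℝ) - 1) / (d + 1)) •
        (w • ketBra (phiMinus p.1 p.2) + (1 - w) • ketBra (phiPlus p.1 p.2)) +
      (2 / ((d : ℝ) + 1)) • (w • ketBra (phiMinus p.1 p.2) +
        ((1 - w) / 2) • (ketBra (ket p.1 p.1) + ketBra (ket p.2 p.2))) with hT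
  have hTK : ∀ p ∈ Finset.univ.filter (fun p : Fin d × Fin d => p.1 < p.2), T p ∈ K := by
    intro p hp
    have hlt : p.1 < p.2 := by simpa using hp
    have ha := star_single_dotProduct_self p.1
    have hb := star_single_dotProduct_self p.2
    have hab := star_single_dotProduct_of_ne hlt.ne
    have hba := star_single_dotProduct_of_ne hlt.ne'
    have h1 := antisym_add_sym_mem hK hw0 hw1 (hKopt _ _ ha hb hab) (hKopt _ _ hb ha hba)
    have h2 := antisym_add_diag_mem hK hw0 hw1 hKopt ha hb hab
    rw [← phiMinus_eq, ← phiPlus_eq] at h1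
    rw [← phiMinus_eq, ← ket_eq_tensor, ← ket_eq_tensor] at h2
    refine hK h1 h2 (div_nonneg (by linarith) (by linarith)) (by positivity) ?_
    field_simp
    ring
  have hcard := sum_lt_add_swap_add_diag (d := d) (fun _ => (1 : ℝ))
  simp only [Finset.sum_const, Finset.card_univ, Fintype.card_prod, Fintype.card_fin,
    nsmul_eq_mul, Nat.cast_mul, mul_one] at hcard
  have hmem := hK.sum_mem (t := Finset.univ.filter (fun p : Fin d × Fin d => p.1 < p.2))
    (w := fun _ => 2 / ((d : ℝ) * (d - 1))) (z := T)
    (fun _ _ => div_nonneg (by norm_num) (mul_nonneg (by linarith) (by linarith)))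
    (by
      rw [Finset.sum_const, nsmul_eq_mul, mul_div_assoc', div_eq_one_iff_eq (by positivity)]
      linarith) hTK
  have hdiag := sum_lt_add_swap_add_diag (fun p : Fin d × Fin d => ketBra (ket p.1 p.1))
  rw [Fintype.sum_prod_type] at hdiag
  simp only [Prod.fst_swap, Finset.sum_const, Finset.card_univ, Fintype.card_fin,
    ← Finset.smul_sum] at hdiag
  have hdiag' : ∑ p : Fin d × Fin d with p.1 < p.2, (ketBra (ket p.1 p.1) + ketBra (ket p.2 p.2)) =
      ((d : ℝ) - 1) • ∑ i : Fin d, ketBra (ket i i) := by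
    rw [sub_smul, one_smul, Nat.cast_smul_eq_nsmul, ← hdiag, add_sub_cancel_right]
  convert hmem using 1
  rw [wernerState_eq, ← Finset.smul_sum, hT, Finset.sum_add_distrib, ← Finset.smul_sum,
    ← Finset.smul_sum, Finset.sum_add_distrib, Finset.sum_add_distrib, ← Finset.smul_sum,
    ← Finset.smul_sum, ← Finset.smul_sum, hdiag', antisymProj, symProj]
  match_scalars <;> field_simp
  ring

/-- The vector with amplitudes `χ (g i) / √d`, for the standard character `χ` of `ℤ/3`. -/
noncomputable def phaseVec (g : Fin d → ZMod 3) : Fin d → ℂ :=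
  fun i => ((1 / √d : ℝ) : ℂ) * ZMod.stdAddChar (g i)

theorem star_stdAddChar (x : ZMod 3) : star (ZMod.stdAddChar x : ℂ) = ZMod.stdAddChar (-x) := by
  rw [AddChar.map_neg_eq_conj]
  rfl

theorem inv_sqrt_mul_self : ((1 / √d : ℝ) : ℂ) * ((1 / √d : ℝ) : ℂ) = 1 / d := by
  rw [← Complex.ofReal_mul, div_mul_div_comm, Real.mul_self_sqrt (by positivity)]
  norm_num

theorem star_phaseVec_dotProduct_self (hd : d ≠ 0) (g : Fin d → ZMod 3) :
    star (phaseVec g) ⬝ᵥ phaseVec g = 1 := by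
  have hr : star ((1 / √d : ℝ) : ℂ) = ((1 / √d : ℝ) : ℂ) := Complex.conj_ofReal _
  have h : ∀ i, star (phaseVec g i) * phaseVec g i = 1 / d := by
    intro i
    rw [phaseVec, star_mul', hr, star_stdAddChar, mul_mul_mul_comm, inv_sqrt_mul_self,
      ← AddChar.map_add_eq_mul, neg_add_cancel, AddChar.map_zero_eq_one, mul_one]
  simp only [dotProduct, Pi.star_apply, h, Finset.sum_const, Finset.card_univ, Fintype.card_fin,
    nsmul_eq_mul]
  field_simp

/-- Character orthogonality: shifting `g` by a unit vector multiplies the sum by a root of unity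
other than `1`. Each coefficient of the exponent lies between `-2` and `2`, so modulo `3` it
vanishes only when it is `0`; modulo `2` the coherences between `|ii⟩` and `|jj⟩` would survive. -/
theorem sum_stdAddChar_eq_zero {a b : Fin d × Fin d} (h1 : a ≠ b) (h2 : a ≠ b.swap) :
    ∑ g : Fin d → ZMod 3, (ZMod.stdAddChar (g a.1 + g a.2 - g b.1 - g b.2) : ℂ) = 0 := by
  obtain ⟨i, k⟩ := a
  obtain ⟨j, l⟩ := b
  simp only [ne_eq, Prod.mk.injEq, Prod.swap_prod_mk] at h1 h2 ⊢
  obtain ⟨x, hx⟩ : ∃ x : Fin d, (Pi.single x 1 : Fin d → ZMod 3) i +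
      (Pi.single x 1 : Fin d → ZMod 3) k - (Pi.single x 1 : Fin d → ZMod 3) j -
      (Pi.single x 1 : Fin d → ZMod 3) l ≠ 0 := by
    by_contra! h
    have hi := h i
    have hk := h k
    simp only [Pi.single_apply] at hi hk
    by_cases e1 : k = i <;> by_cases e2 : j = i <;> by_cases e3 : l = i <;>
      by_cases e4 : j = k <;> by_cases e5 : l = k <;> simp_all
    all_goals
      revert hi
      decide
  set φ : (Fin d → ZMod 3) → ZMod 3 := fun g => g i + g k - g j - g l with hφ
  set S := ∑ g : Fin d → ZMod 3, (ZMod.stdAddChar (φ g) : ℂ) with hS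
  have hshift : S = ZMod.stdAddChar (φ (Pi.single x 1)) * S := by
    rw [hS, Finset.mul_sum]
    refine (Equiv.sum_comp (Equiv.addLeft (Pi.single x 1 : Fin d → ZMod 3))
      (fun g => (ZMod.stdAddChar (φ g) : ℂ))).symm.trans ?_
    refine Finset.sum_congr rfl fun g _ => ?_
    rw [← AddChar.map_add_eq_mul]
    congr 1
    simp only [hφ, Equiv.coe_addLeft, Pi.add_apply]
    ring
  have hne : (ZMod.stdAddChar (φ (Pi.single x 1)) : ℂ) ≠ 1 := by
    intro h
    rw [← AddChar.map_zero_eq_one (ZMod.stdAddChar (N := 3))] at h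
    exact hx (ZMod.injective_stdAddChar h)
  have : (1 - ZMod.stdAddChar (φ (Pi.single x 1))) * S = 0 := by linear_combination hshift
  exact (mul_eq_zero.1 this).resolve_left (sub_ne_zero.2 hne.symm)

theorem ketBra_phaseVec_apply (g : Fin d → ZMod 3) (a b : Fin d × Fin d) :
    ketBra (tensor (phaseVec g) (phaseVec g)) a b =
      (1 / (d : ℂ)) ^ 2 * ZMod.stdAddChar (g a.1 + g a.2 - g b.1 - g b.2) := by
  have hr : star ((1 / √d : ℝ) : ℂ) = ((1 / √d : ℝ) : ℂ) := Complex.conj_ofReal _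
  simp only [ketBra_apply, tensor_apply, phaseVec, star_mul', hr, star_stdAddChar]
  rw [show g a.1 + g a.2 - g b.1 - g b.2 = g a.1 + g a.2 + -g b.1 + -g b.2 by ring,
    AddChar.map_add_eq_mul, AddChar.map_add_eq_mul, AddChar.map_add_eq_mul,
    ← inv_sqrt_mul_self]
  ring

/-- At `w = 0` products `a ⊗ a` suffice. Averaging over the phases leaves `(1 + F - D)/d²` with `D =
∑ |ii⟩⟨ii|`; mixing with `D/d` in proportion `d : 1` restores the missing diagonal. -/
theorem wernerState_zero_mem_of_convex (hd : d ≠ 0) {K : Set (BipOp d)} (hK : Convex ℝ K)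
    (hKprod : ∀ a : Fin d → ℂ, star a ⬝ᵥ a = 1 → ketBra (tensor a a) ∈ K) :
    wernerState d 0 ∈ K := by
  have hd0 : (d : ℝ) ≠ 0 := by exact_mod_cast hd
  have hd2 : (d : ℝ) + 1 ≠ 0 := by positivity
  have hN : ((Fintype.card (Fin d → ZMod 3) : ℕ) : ℝ) ≠ 0 := by
    exact_mod_cast Fintype.card_ne_zero
  have h1 : ∑ g : Fin d → ZMod 3, (1 / (Fintype.card (Fin d → ZMod 3) : ℝ)) •
      ketBra (tensor (phaseVec g) (phaseVec g)) ∈ K := by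
    refine hK.sum_mem (fun _ _ => by positivity) ?_
      fun g _ => hKprod _ (star_phaseVec_dotProduct_self hd g)
    rw [Finset.sum_const, Finset.card_univ, nsmul_eq_mul, mul_one_div_cancel hN]
  have h2 : ∑ i : Fin d, (1 / (d : ℝ)) • ketBra (ket i i) ∈ K := by
    refine hK.sum_mem (fun _ _ => by positivity) ?_ fun i _ => ?_
    · rw [Finset.sum_const, Finset.card_univ, nsmul_eq_mul, Fintype.card_fin,
        mul_one_div_cancel hd0]
    · rw [ket_eq_tensor]
      exact hKprod _ (star_single_dotProduct_self i)
  have h := hK h1 h2 (a := d / (d + 1)) (b := 1 / (d + 1)) (by positivity) (by positivity)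
    (by field_simp)
  convert h using 1
  have hdC : (d : ℂ) ≠ 0 := by exact_mod_cast hd
  have hd2C : (d : ℂ) + 1 ≠ 0 := by exact_mod_cast hd2
  have hNC : ((Fintype.card (Fin d → ZMod 3) : ℕ) : ℂ) ≠ 0 := by exact_mod_cast hN
  ext a b
  have e1 : (∑ i : Fin d, ketBra (ket i i)) a b = if a = b ∧ a = b.swap then 1 else 0 := by
    obtain ⟨i, k⟩ := a
    obtain ⟨j, l⟩ := b
    simp only [Matrix.sum_apply, ketBra_apply, ket_apply]
    rw [Finset.sum_eq_single i]
    · simp only [Prod.mk.injEq, Prod.swap_prod_mk]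
      by_cases e1 : k = i <;> by_cases e2 : j = i <;> by_cases e3 : l = i <;> simp_all <;> grind
    · intro m _ hm
      simp [hm.symm]
    · simp
  have e2 : (∑ g : Fin d → ZMod 3, ketBra (tensor (phaseVec g) (phaseVec g))) a b =
      (1 / (d : ℂ)) ^ 2 *
        if a = b ∨ a = b.swap then (Fintype.card (Fin d → ZMod 3) : ℂ) else 0 := by
    simp only [Matrix.sum_apply, ketBra_phaseVec_apply, ← Finset.mul_sum]
    congr 1
    split_ifs with hab
    · have : ∀ g : Fin d → ZMod 3, g a.1 + g a.2 - g b.1 - g b.2 = 0 := by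
        intro g
        rcases hab with rfl | rfl
        · ring
        · simp only [Prod.fst_swap, Prod.snd_swap]; ring
      simp [this]
    · push Not at hab
      exact sum_stdAddChar_eq_zero hab.1 hab.2
  rw [wernerState, symProj_eq, ← Finset.smul_sum, ← Finset.smul_sum]
  simp only [Matrix.add_apply, Matrix.smul_apply, e1, e2, Matrix.one_apply, swapMatrix,
    Matrix.of_apply, Complex.real_smul, smul_eq_mul]
  push_cast
  split_ifs <;> first | (exfalso; tauto) | (field_simp; done) | (field_simp; ring)

end Twirl

/-! ### The convex roof as convex envelope -/

section Envelope

variable {d : ℕ} {q s : ℝ}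

theorem decompositionValues_nonneg (hq : 1 < q) (hqs : 1 ≤ q * s) {ρ : BipOp d} {x : ℝ}
    (hx : x ∈ decompositionValues q s ρ) : 0 ≤ x := by
  obtain ⟨n, p, ψ, hp, -, hψ, -, rfl⟩ := hx
  exact Finset.sum_nonneg fun i _ => mul_nonneg (hp i) (pureConcurrence_nonneg hq hqs (hψ i))

theorem bddBelow_decompositionValues (hq : 1 < q) (hqs : 1 ≤ q * s) (ρ : BipOp d) :
    BddBelow (decompositionValues q s ρ) :=
  ⟨0, fun _ hx => decompositionValues_nonneg hq hqs hx⟩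

/-- Near-optimal decompositions are mixed up to `ε`. Nonemptiness is needed to choose them, as `sInf
∅ = 0` carries no information. -/
theorem concurrence_convex_comb_le (hq : 1 < q) (hqs : 1 ≤ q * s) {ρ σ : BipOp d} {t u : ℝ}
    (hρ : (decompositionValues q s ρ).Nonempty) (hσ : (decompositionValues q s σ).Nonempty)
    (ht : 0 ≤ t) (hu : 0 ≤ u) (htu : t + u = 1) :
    concurrence q s (t • ρ + u • σ) ≤ t * concurrence q s ρ + u * concurrence q s σ := by
  refine le_of_forall_pos_le_add fun ε hε => ?_
  obtain ⟨x, hx, hxε⟩ := exists_lt_of_csInf_lt hρ (lt_add_of_pos_right (concurrence q s ρ) hε)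
  obtain ⟨y, hy, hyε⟩ := exists_lt_of_csInf_lt hσ (lt_add_of_pos_right (concurrence q s σ) hε)
  have h := csInf_le (bddBelow_decompositionValues hq hqs _)
    (decompositionValues_convex_comb hx hy ht hu htu)
  have h1 := mul_le_mul_of_nonneg_left hxε.le ht
  have h2 := mul_le_mul_of_nonneg_left hyε.le hu
  calc concurrence q s (t • ρ + u • σ) ≤ t * x + u * y := h
    _ ≤ t * concurrence q s ρ + u * concurrence q s σ + (t + u) * ε := by linarith
    _ = _ := by rw [htu, one_mul]

theorem wernerState_convex_comb {t u : ℝ} (htu : t + u = 1) (w z : ℝ) :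
    wernerState d (t * w + u * z) = t • wernerState d w + u • wernerState d z := by
  obtain rfl : u = 1 - t := by linarith
  simp only [wernerState_eq]
  match_scalars <;> ring

theorem isLeast_wernerXi (hd : 2 ≤ d) (hq : 1 < q) (hqs : 1 ≤ q * s) {w : ℝ}
    (hw : w ∈ Set.Icc (0 : ℝ) 1) : IsLeast (wernerPureValues d q s w) (wernerXi d q s w) := by
  rcases le_total w (1 / 2) with h | h
  · have := isLeast_wernerPureValues_of_le_half hd hq hqs hw.1 h
    rwa [wernerXi, this.csInf_eq]
  · have := isLeast_wernerPureValues_of_half_le hd hq hqs h hw.2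
    rwa [wernerXi, this.csInf_eq]

theorem wernerXi_mem_decompositionValues (hd : 2 ≤ d) (hq : 1 < q) (hqs : 1 ≤ q * s) {w : ℝ}
    (hw : w ∈ Set.Icc (0 : ℝ) 1) :
    wernerXi d q s w ∈ decompositionValues q s (wernerState d w) := by
  have hhalf : ∀ z : ℝ, 1 / 2 ≤ z → z ≤ 1 →
      xiValue q s z ∈ decompositionValues q s (wernerState d z) := by
    intro z hz hz1
    have hz0 : 0 ≤ z := by linarith
    refine wernerState_mem_of_convex hd (convex_setOf_mem_decompositionValues q s (xiValue q s z))
      hz0 hz1 fun a b ha hb hab => ?_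
    have h := pureConcurrence_mem_decompositionValues (q := q) (s := s)
      (norm_optimalVec ha hb hab hz0 hz1)
    rwa [pureConcurrence_optimalVec hq hqs ha hb hab hz0 hz1] at h
  rcases le_total w (1 / 2) with h | h
  · rw [wernerXi, (isLeast_wernerPureValues_of_le_half hd hq hqs hw.1 h).csInf_eq]
    have h0 : (0 : ℝ) ∈ decompositionValues q s (wernerState d 0) := by
      refine wernerState_zero_mem_of_convex (by omega)
        (convex_setOf_mem_decompositionValues q s 0) fun a ha => ?_
      have h := pureConcurrence_mem_decompositionValues (q := q) (s := s) (norm_tensor ha ha)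
      rwa [pureConcurrence_tensor hq hqs ha ha] at h
    have h1 := hhalf (1 / 2) le_rfl (by norm_num)
    rw [xiValue_half hq] at h1
    have h2 := decompositionValues_convex_comb h0 h1 (t := 1 - 2 * w) (u := 2 * w) (by linarith)
      (by linarith [hw.1]) (by ring)
    rw [← wernerState_convex_comb (by ring)] at h2
    rwa [mul_zero, mul_zero, add_zero, show 0 + 2 * w * (1 / 2) = w by ring] at h2
  · rw [wernerXi, (isLeast_wernerPureValues_of_half_le hd hq hqs h hw.2).csInf_eq]
    exact hhalf w h hw.2

/-- The Werner parameter is linear in the state, so those of the pure components average to `w`;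
Jensen for `h` and `h ≤ ξ` finish. -/
theorem le_of_mem_decompositionValues (hd : 2 ≤ d) (hq : 1 < q) (hqs : 1 ≤ q * s) {h : ℝ → ℝ}
    (hh : ConvexOn ℝ (Set.Icc 0 1) h) (hle : ∀ z ∈ Set.Icc (0 : ℝ) 1, h z ≤ wernerXi d q s z)
    {w x : ℝ} (hx : x ∈ decompositionValues q s (wernerState d w)) : h w ≤ x := by
  obtain ⟨n, p, ψ, hp, hp1, hψ, hρ, rfl⟩ := hx
  have hw : w = ∑ i, p i * wernerParam (ketBra (ψ i)) := by
    rw [← wernerParam_sum, ← hρ, wernerParam_wernerState hd]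
  have hJ := hh.map_sum_le (t := Finset.univ) (w := p) (p := fun i => wernerParam (ketBra (ψ i)))
    (fun i _ => hp i) hp1 fun i _ => wernerParam_ketBra_mem_Icc (hψ i)
  simp only [smul_eq_mul] at hJ
  rw [hw]
  refine hJ.trans (Finset.sum_le_sum fun i _ => mul_le_mul_of_nonneg_left ?_ (hp i))
  have hmem := wernerParam_ketBra_mem_Icc (hψ i)
  exact (hle _ hmem).trans ((isLeast_wernerXi hd hq hqs hmem).2 ⟨ψ i, hψ i, rfl, rfl⟩)

theorem isConvexEnvelopeOn_concurrence_wernerState (hd : 2 ≤ d) (hq : 1 < q) (hqs : 1 ≤ q * s) :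
    IsConvexEnvelopeOn (Set.Icc 0 1) (fun w => wernerXi d q s w)
      (fun w => concurrence q s (wernerState d w)) := by
  refine ⟨⟨convex_Icc 0 1, fun w hw z hz t u ht hu htu => ?_⟩, fun w hw => ?_,
    fun h hh hle w hw => ?_⟩
  · simp only [smul_eq_mul]
    rw [wernerState_convex_comb htu]
    exact concurrence_convex_comb_le hq hqs ⟨_, wernerXi_mem_decompositionValues hd hq hqs hw⟩
      ⟨_, wernerXi_mem_decompositionValues hd hq hqs hz⟩ ht hu htu
  · exact csInf_le (bddBelow_decompositionValues hq hqs _)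
      (wernerXi_mem_decompositionValues hd hq hqs hw)
  · exact le_csInf ⟨_, wernerXi_mem_decompositionValues hd hq hqs hw⟩
      fun x hx => le_of_mem_decompositionValues hd hq hqs hh hle hx

end Envelope

end QSConcurrence

theorem mainTheorem9 (d : ℕ) (hd : 2 ≤ d) (q s : ℝ) (hq : 1 < q) (hqs : 1 ≤ q * s) :
    (∀ w ∈ Set.Icc (0 : ℝ) 1,
      IsLeast (QSConcurrence.wernerPureValues d q s w) (QSConcurrence.wernerXi d q s w)) ∧
    (∀ w : ℝ, 0 ≤ w → w ≤ 1 / 2 → QSConcurrence.wernerXi d q s w = 0) ∧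
    (∀ w : ℝ, 1 / 2 < w → w ≤ 1 → ∀ G : ℝ, G = 2 * √(w * (1 - w)) →
      QSConcurrence.wernerXi d q s w =
        1 - (((1 + G) / 2) ^ q + ((1 - G) / 2) ^ q) ^ s) ∧
    QSConcurrence.IsConvexEnvelopeOn (Set.Icc 0 1)
      (fun w => QSConcurrence.wernerXi d q s w)
      (fun w => QSConcurrence.concurrence q s (QSConcurrence.wernerState d w)) := by
  refine ⟨fun w hw => QSConcurrence.isLeast_wernerXi hd hq hqs hw, fun w hw0 hw => ?_,
    fun w hw hw1 G hG => ?_, QSConcurrence.isConvexEnvelopeOn_concurrence_wernerState hd hq hqs⟩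
  · exact (QSConcurrence.isLeast_wernerPureValues_of_le_half hd hq hqs hw0 hw).csInf_eq
  · rw [hG]
    exact (QSConcurrence.isLeast_wernerPureValues_of_half_le hd hq hqs hw.le hw1).csInf_eq
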